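/- Let $\Omega\subset\mathbb R^2$ be either a bounded domain (nonempty, open, connected) with smooth ($C^\infty$) boundary or $\Omega=\mathbb R^2$, and let $\Phi(t)=e^{t^2}-1$. Let $$L^\Phi(\Omega)=\Big\{u\in L^1_{loc}(\Omega):\ \int_\Omega\Phi(|u|/\lambda)\,dx<\infty\ \text{for some }\lambda>0\Big\},\qquad \|u\|_\Phi=\inf\Big\{\lambda>0:\int_\Omega\Phi(|u|/\lambda)\,dx\le1\Big\},$$ and let $E_\Phi(\Omega)$ be the closure in $(L^\Phi(\Omega),\|\cdot\|_\Phi)$ of $L^\infty(\Omega)$ if $|\Omega|<\infty$, and of $C_0^\infty(\Omega)$ if $|\Omega|=\infty$. Let $H^1(\Omega)$ have the norm $\|u\|_{H^1(\Omega)}=\big(\int_\Omega(|\nabla u|^2+u^2)\,dx\big)^{1/2}$, and let $H^1_0(\Omega)$ be the closure of $C_0^\infty(\Omega)$ in $H^1(\Omega)$. Then for $X=H^1_0(\Omega)$ and for $X=H^1(\Omega)$ the embedding $X\hookrightarrow E_\Phi(\Omega)$ is continuous: $X\subset E_\Phi(\Omega)$, and there is a constant $C>0$, depending only on $\Omega$,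 such that $$\|u\|_\Phi\le C\,\|u\|_{H^1(\Omega)}\qquad\text{for all }u\in X.$$ If $\Omega$ is bounded and $X=H^1_0(\Omega)$, this also holds with $\|u\|_{H^1(\Omega)}$ replaced by the norm $\big(\int_\Omega|\nabla u|^2\,dx\big)^{1/2}$. -/

import Mathlib

open MeasureTheory Set
open scoped ContDiff

namespace OrliczPlane

/-- The plane with its Euclidean norm and Lebesgue measure. -/
abbrev Plane : Type := EuclideanSpace ℝ (Fin 2)

/-- Bounded domain with smooth boundary: a nonempty connected bounded open set which, near each of
its boundary points and in suitable orthonormal coordinates `y = L x`, is the region above the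
graph of a smooth function. -/
structure IsSmoothBoundedDomain (Ω : Set Plane) : Prop where
  isOpen : IsOpen Ω
  isConnected : IsConnected Ω
  isBounded : Bornology.IsBounded Ω
  smooth_boundary : ∀ x₀ ∈ frontier Ω, ∃ (L : Plane ≃ₗᵢ[ℝ] Plane) (γ : ℝ → ℝ) (r : ℝ),
    ContDiff ℝ ∞ γ ∧ 0 < r ∧ ∀ x ∈ Metric.ball x₀ r, (x ∈ Ω ↔ γ (L x 0) < L x 1)

/-- The test functions `C_0^∞(Ω)`: smooth, with compact support contained in `Ω`. -/
def IsTestFunction (Ω : Set Plane) (φ : Plane → ℝ) : Prop :=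
  ContDiff ℝ ∞ φ ∧ HasCompactSupport φ ∧ tsupport φ ⊆ Ω

/-- `G` is the weak (distributional) gradient of `u` on the open set `Ω`. -/
def IsWeakGradient (Ω : Set Plane) (u : Plane → ℝ) (G : Plane → Plane) : Prop :=
  LocallyIntegrableOn u Ω ∧ LocallyIntegrableOn G Ω ∧
    ∀ φ : Plane → ℝ, IsTestFunction Ω φ → ∀ i : Fin 2,
      ∫ x in Ω, u x * fderiv ℝ φ x (EuclideanSpace.single i 1) = -∫ x in Ω, G x i * φ x

open Classical in
/-- The weak gradient of `u` on `Ω` (unique up to a null set of `Ω`; zero if there is none). -/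
noncomputable def weakGradient (Ω : Set Plane) (u : Plane → ℝ) : Plane → Plane :=
  if h : ∃ G, IsWeakGradient Ω u G then h.choose else 0

/-- Membership in `H¹(Ω)`: `u ∈ L²(Ω)` and `u` has a weak gradient in `L²(Ω)`. -/
def MemH1 (Ω : Set Plane) (u : Plane → ℝ) : Prop :=
  MemLp u 2 (volume.restrict Ω) ∧
    ∃ G : Plane → Plane, IsWeakGradient Ω u G ∧ MemLp G 2 (volume.restrict Ω)

/-- The Dirichlet norm `(∫_Ω |∇u|²)^{1/2}`, for `u ∈ H¹(Ω)`. -/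
noncomputable def gradNorm (Ω : Set Plane) (u : Plane → ℝ) : ℝ :=
  Real.sqrt (∫ x in Ω, ‖weakGradient Ω u x‖ ^ 2)

/-- The usual norm `(∫_Ω |∇u|² + ∫_Ω u²)^{1/2}` of `u ∈ H¹(Ω)`. -/
noncomputable def h1Norm (Ω : Set Plane) (u : Plane → ℝ) : ℝ :=
  Real.sqrt ((∫ x in Ω, ‖weakGradient Ω u x‖ ^ 2) + ∫ x in Ω, u x ^ 2)

/-- Membership in `H¹₀(Ω)`, the closure of `C_0^∞(Ω)` in `H¹(Ω)`. -/
def MemH10 (Ω : Set Plane) (u : Plane → ℝ) : Prop :=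
  MemH1 Ω u ∧ ∀ ε : ℝ, 0 < ε → ∃ φ : Plane → ℝ, IsTestFunction Ω φ ∧
    h1Norm Ω (fun x => u x - φ x) < ε

/-- The function `Φ(t) = exp(t²) - 1`. -/
noncomputable def Phi (t : ℝ) : ℝ := Real.exp (t ^ 2) - 1

/-- The integral `∫_Ω A(|u|/l) dx ∈ [0, ∞]`, for an N-function `A : ℝ → [0, ∞)`. -/
noncomputable def modular (A : ℝ → ℝ) (Ω : Set Plane) (u : Plane → ℝ) (l : ℝ) : ENNReal :=
  ∫⁻ x in Ω, ENNReal.ofReal (A (|u x| / l))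

/-- Membership in the Orlicz space `L^A(Ω)`. -/
def MemOrlicz (A : ℝ → ℝ) (Ω : Set Plane) (u : Plane → ℝ) : Prop :=
  LocallyIntegrableOn u Ω ∧ ∃ l : ℝ, 0 < l ∧ modular A Ω u l < ⊤

/-- The Luxemburg norm of `u ∈ L^A(Ω)`. -/
noncomputable def luxemburgNorm (A : ℝ → ℝ) (Ω : Set Plane) (u : Plane → ℝ) : ℝ :=
  sInf {l : ℝ | 0 < l ∧ modular A Ω u l ≤ 1}

/-- Membership in `E_A(Ω)`: the closure in `L^A(Ω)`, for the Luxemburg norm, of `L^∞(Ω)` if `Ω` has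
finite measure, and of `C_0^∞(Ω)` if `Ω` has infinite measure. -/
def MemE (A : ℝ → ℝ) (Ω : Set Plane) (u : Plane → ℝ) : Prop :=
  MemOrlicz A Ω u ∧ ∀ ε : ℝ, 0 < ε → ∃ v : Plane → ℝ,
    (volume Ω < ⊤ → MemLp v ⊤ (volume.restrict Ω)) ∧
    (volume Ω = ⊤ → IsTestFunction Ω v) ∧
    MemOrlicz A Ω (fun x => u x - v x) ∧ luxemburgNorm A Ω (fun x => u x - v x) < ε

end OrliczPlane

/-! Trudinger's argument through Riesz potentials. A smooth bounded domain, like the plane,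
satisfies a uniform interior cone condition (`exists_coneCondition`). Averaging the fundamental
theorem of calculus over the segments of a cone bounds `|u(x)|` by a constant times the potential `f
⋆ₗ rieszKernel R`, where `f = |u| + |∇u|` on `Ω` and `0` outside (`exists_ae_enorm_le_riesz`). No
extension operator is needed, and `f` lies in `L²` with norm controlled by the `H¹` norm.

Young's inequality bounds the `2k`-th moment of the potential by the norm of the kernel in `L^r`, `r
= 2k/(k+1)`. In the plane the kernel just fails to be square integrable: `∫ |y|^(-r)` over a ball
grows only linearly in `k`. The moments therefore grow like `k!` up to geometric factors, and the
exponential series defining the modular of `Phi` sums to at most `1` once `l` is a large multiple of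
the `L²` norm of `f` (`exists_modular_le_one_of_le_riesz`).

Since only the `L²` size of `f` matters, splitting `f` into a bounded, boundedly supported part and
a part small in `L²` places `u` in `E_Φ` (`memE_of_le_riesz`): the first part has a bounded
potential of bounded support, and the second a potential of small norm. For `H¹₀` of a bounded
domain, Poincaré's inequality replaces the full norm by the Dirichlet norm. -/

namespace OrliczPlane

open scoped ENNReal NNReal Topology

/-! ### Exponential integrability of truncated Riesz potentials. -/

/-- The truncated Riesz kernel `1_{‖y‖ ≤ R} ‖y‖⁻¹`. -/
noncomputable def rieszKernel (R : ℝ) : Plane → ℝ≥0∞ :=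
  (Metric.closedBall 0 R).indicator fun y => ‖y‖ₑ⁻¹

lemma measurable_rieszKernel (R : ℝ) : Measurable (rieszKernel R) := by
  unfold rieszKernel
  exact Measurable.indicator (by fun_prop) Metric.isClosed_closedBall.measurableSet

/-- Young's inequality `L² ⋆ L^r ⊆ L^(2k)`, where `1 + 1/(2k) = 1/2 + 1/r`, raised to the power `2k`
so that both integrals appear with natural exponents. -/
lemma lintegral_lconvolution_pow_le {f g : Plane → ℝ≥0∞} (hf : AEMeasurable f)
    (hg : Measurable g) {k : ℕ} (hk : 1 ≤ k) :
    ∫⁻ x, (f ⋆ₗ g) x ^ (2 * k) ≤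
      (∫⁻ y, g y ^ (2 * k / (k + 1) : ℝ)) ^ (k + 1) * (∫⁻ y, f y ^ 2) ^ k := by
  set r : ℝ := 2 * k / (k + 1) with hr
  have hk0 : (0 : ℝ) < k := by exact_mod_cast hk
  have hk1 : (1 : ℝ) ≤ k := by exact_mod_cast hk
  have hr0 : 0 ≤ r := by positivity
  set A : ℝ≥0∞ := ∫⁻ y, g y ^ r with hA
  set B : ℝ≥0∞ := ∫⁻ y, f y ^ 2 with hB
  have htrans : ∀ x, ∫⁻ y, g (-y + x) ^ r = A := by
    intro x
    rw [hA, ← lintegral_sub_left_eq_self (fun y => g y ^ r) x]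
    simp only [neg_add_eq_sub]
  have hpt : ∀ x, (f ⋆ₗ g) x ^ (2 * k) ≤
      (∫⁻ y, f y ^ 2 * g (-y + x) ^ r) * A ^ k * B ^ (k - 1) := by
    intro x
    -- Hölder with three factors, `f g = (f² g^r)^(1/2k) · (g^r)^(1/2) · (f²)^((k-1)/2k)`. After the
    -- power `2k` only the first factor still depends on `x`, and Tonelli integrates it.
    have h := ENNReal.lintegral_prod_norm_pow_le (μ := (volume : Measure Plane))
      (Finset.univ : Finset (Fin 3))
      (f := ![fun y => f y ^ 2 * g (-y + x) ^ r, fun y => g (-y + x) ^ r, fun y => f y ^ 2])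
      (p := ![1 / (2 * k), 1 / 2, (k - 1) / (2 * k)]) ?_ ?_ ?_
    · simp only [Fin.prod_univ_three, Matrix.cons_val_zero, Matrix.cons_val_one,
        Matrix.cons_val_two, Matrix.tail_cons, Matrix.head_cons, htrans] at h
      have heq : ∀ y, (f y ^ 2 * g (-y + x) ^ r) ^ (1 / (2 * k) : ℝ) *
          (g (-y + x) ^ r) ^ (1 / 2 : ℝ) * (f y ^ 2) ^ ((k - 1) / (2 * k) : ℝ) =
          f y * g (-y + x) := by
        intro y
        have e1 : (f y ^ 2 * g (-y + x) ^ r) ^ (1 / (2 * k) : ℝ) =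
            f y ^ (1 / k : ℝ) * g (-y + x) ^ (1 / (k + 1) : ℝ) := by
          rw [ENNReal.mul_rpow_of_nonneg _ _ (by positivity), ← ENNReal.rpow_mul,
            ← ENNReal.rpow_natCast, ← ENNReal.rpow_mul]
          congr 2
          · push_cast; field_simp
          · rw [hr]; field_simp
        have e2 : (g (-y + x) ^ r) ^ (1 / 2 : ℝ) = g (-y + x) ^ (k / (k + 1) : ℝ) := by
          rw [← ENNReal.rpow_mul]
          congr 1
          rw [hr]; field_simp
        have e3 : (f y ^ 2) ^ ((k - 1) / (2 * k) : ℝ) = f y ^ ((k - 1) / k : ℝ) := by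
          rw [← ENNReal.rpow_natCast, ← ENNReal.rpow_mul]
          congr 1
          push_cast; field_simp
        rw [e1, e2, e3, mul_assoc (f y ^ _), ← ENNReal.rpow_add_of_nonneg _ _ (by positivity)
          (by positivity), mul_right_comm, ← ENNReal.rpow_add_of_nonneg _ _ (by positivity)
          (div_nonneg (by linarith) hk0.le)]
        have : (1 / k + (k - 1) / k : ℝ) = 1 := by field_simp; ring
        rw [this]
        have : (1 / (k + 1) + k / (k + 1) : ℝ) = 1 := by field_simp; ring
        rw [this, ENNReal.rpow_one, ENNReal.rpow_one]
      simp only [heq] at h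
      rw [lconvolution_def]
      refine (pow_le_pow_left' h _).trans_eq ?_
      rw [mul_pow, mul_pow]
      simp only [← ENNReal.rpow_natCast, ← ENNReal.rpow_mul]
      rw [show (1 / (2 * k) * ((2 * k : ℕ) : ℝ) : ℝ) = 1 by push_cast; field_simp,
        show (1 / 2 * ((2 * k : ℕ) : ℝ) : ℝ) = k by push_cast; ring,
        show ((k - 1) / (2 * k) * ((2 * k : ℕ) : ℝ) : ℝ) = ((k - 1 : ℕ) : ℝ) by
          rw [Nat.cast_sub hk]; push_cast; field_simp,
        ENNReal.rpow_one]
      simp only [ENNReal.rpow_natCast]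
      simp [hB]
    · intro i _
      fin_cases i
      · exact (hf.pow_const 2).mul (by fun_prop)
      · show AEMeasurable (fun y => g (-y + x) ^ r)
        fun_prop
      · exact hf.pow_const 2
    · simp only [Fin.sum_univ_three, Matrix.cons_val_zero, Matrix.cons_val_one, Matrix.cons_val]
      field_simp; ring
    · intro i _
      fin_cases i
      · show (0 : ℝ) ≤ 1 / (2 * k); positivity
      · show (0 : ℝ) ≤ 1 / 2; positivity
      · show (0 : ℝ) ≤ (k - 1) / (2 * k)
        exact div_nonneg (by linarith) (by positivity)
  have hconv : ∫⁻ x, ∫⁻ y, f y ^ 2 * g (-y + x) ^ r = B * A := by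
    rw [lintegral_lintegral_swap]
    · have : ∀ y, ∫⁻ x, f y ^ 2 * g (-y + x) ^ r = f y ^ 2 * A := by
        intro y
        rw [lintegral_const_mul _ (by fun_prop)]
        congr 1
        exact lintegral_add_left_eq_self (fun x => g x ^ r) (-y)
      simp only [this]
      rw [lintegral_mul_const'' _ (hf.pow_const 2)]
    · refine AEMeasurable.mul ?_ ?_
      · exact (hf.pow_const 2).comp_snd
      · exact Measurable.aemeasurable (by fun_prop)
  have hm : AEMeasurable fun x => ∫⁻ y, f y ^ 2 * g (-y + x) ^ r :=
    aemeasurable_lconvolution (hf.pow_const 2) (hg.pow_const r).aemeasurable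
  calc ∫⁻ x, (f ⋆ₗ g) x ^ (2 * k)
      ≤ ∫⁻ x, (∫⁻ y, f y ^ 2 * g (-y + x) ^ r) * A ^ k * B ^ (k - 1) := lintegral_mono hpt
    _ = B * A * A ^ k * B ^ (k - 1) := by
        rw [lintegral_mul_const'' _ (hm.mul_const _), lintegral_mul_const'' _ hm, hconv]
    _ = A ^ (k + 1) * B ^ k := by
        obtain ⟨j, rfl⟩ := Nat.exists_eq_add_of_le' hk
        simp only [Nat.add_sub_cancel]
        ring

/-- In polar coordinates the integral is a multiple of `R^(2-r)/(2-r)`, and `2 - r = 2/(k+1)`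
produces the linear growth. As `R ≥ 1`, `R^(2-r) ≤ R²` makes the constant independent of `k`. -/
lemma lintegral_rieszKernel_rpow_le {R : ℝ} (hR : 1 ≤ R) :
    ∃ C : ℝ, 1 ≤ C ∧ ∀ k : ℕ, 1 ≤ k →
      ∫⁻ y, rieszKernel R y ^ (2 * k / (k + 1) : ℝ) ≤ ENNReal.ofReal (C * (k + 1)) := by
  refine ⟨max 1 (volume.real (Metric.ball (0 : Plane) 1) * R ^ 2), le_max_left _ _,
    fun k hk => ?_⟩
  set r : ℝ := 2 * k / (k + 1) with hr
  have hk0 : (0 : ℝ) < k := by exact_mod_cast hk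
  have hr0 : 0 < r := by positivity
  have hr2 : 2 - r = 2 / (k + 1) := by rw [hr]; field_simp; ring
  have hr2' : 0 < 2 - r := by rw [hr2]; positivity
  have hR0 : 0 < R := by linarith
  set F : ℝ → ℝ := (Iic R).indicator fun y => y ^ (-r) with hF
  have hint : IntegrableOn (fun y => y ^ (1 - r)) (Ioc 0 R) := by
    rw [← intervalIntegrable_iff_integrableOn_Ioc_of_le hR0.le]
    exact intervalIntegral.intervalIntegrable_rpow' (by linarith)
  have hfeq : ∀ y ∈ Ioi (0 : ℝ), y ^ (2 - 1) • F y =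
      (Ioc 0 R).indicator (fun y => y ^ (1 - r)) y := by
    intro y hy
    by_cases hyR : y ≤ R
    · rw [hF, indicator_of_mem (show y ∈ Iic R from hyR),
        indicator_of_mem (show y ∈ Ioc 0 R from ⟨hy, hyR⟩)]
      rw [sub_eq_add_neg (1 : ℝ), Real.rpow_add hy]
      simp
    · rw [hF, indicator_of_notMem (show y ∉ Iic R from hyR),
        indicator_of_notMem (show y ∉ Ioc 0 R from fun h => hyR h.2)]
      simp
  have hdim : Module.finrank ℝ Plane = 2 := by simp
  have hFint : Integrable (fun x : Plane => F ‖x‖) := by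
    rw [integrable_fun_norm_addHaar, hdim, integrableOn_congr_fun hfeq measurableSet_Ioi]
    exact ((integrable_indicator_iff measurableSet_Ioc).2 hint).integrableOn
  have hFval : ∫ x : Plane, F ‖x‖ =
      volume.real (Metric.ball (0 : Plane) 1) * ((k + 1) * R ^ (2 - r)) := by
    rw [integral_fun_norm_addHaar, hdim, setIntegral_congr_fun measurableSet_Ioi hfeq,
      setIntegral_indicator measurableSet_Ioc]
    have : Ioi (0 : ℝ) ∩ Ioc 0 R = Ioc 0 R := inter_eq_right.2 fun x hx => hx.1
    rw [this, ← intervalIntegral.integral_of_le hR0.le, integral_rpow (Or.inl (by linarith)),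
      show 1 - r + 1 = 2 - r by ring, Real.zero_rpow hr2'.ne', hr2]
    simp only [nsmul_eq_mul, smul_eq_mul]
    field_simp
    simp only [Nat.cast_ofNat]
    ring
  have hle : ∫⁻ y, rieszKernel R y ^ r ≤ ∫⁻ y : Plane, ENNReal.ofReal (F ‖y‖) := by
    refine lintegral_mono_ae ?_
    -- At the origin the kernel is `⊤` while the real power `0 ^ (-r)` is `0`, so the comparison
    -- holds only off this null point.
    have h0 : ∀ᵐ y : Plane, y ≠ 0 := by simp [ae_iff]
    filter_upwards [h0] with y hy
    have hy' : 0 < ‖y‖ := norm_pos_iff.2 hy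
    unfold rieszKernel
    by_cases hyR : ‖y‖ ≤ R
    · rw [hF, indicator_of_mem (by simpa using hyR), indicator_of_mem (show ‖y‖ ∈ Iic R from hyR),
        Real.rpow_neg hy'.le, ENNReal.ofReal_inv_of_pos (by positivity), ENNReal.inv_rpow,
        ← ENNReal.ofReal_rpow_of_pos hy', ofReal_norm]
    · rw [indicator_of_notMem (by simpa using hyR), ENNReal.zero_rpow_of_pos hr0]
      exact zero_le
  refine hle.trans ?_
  rw [← ofReal_integral_eq_lintegral_ofReal hFint, hFval]
  · apply ENNReal.ofReal_le_ofReal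
    have h1 : R ^ (2 - r) ≤ R ^ 2 := by
      rw [← Real.rpow_natCast]
      exact Real.rpow_le_rpow_of_exponent_le hR (by push_cast; linarith)
    calc volume.real (Metric.ball (0 : Plane) 1) * ((k + 1) * R ^ (2 - r))
        ≤ volume.real (Metric.ball (0 : Plane) 1) * ((k + 1) * R ^ 2) := by gcongr
      _ = volume.real (Metric.ball (0 : Plane) 1) * R ^ 2 * (k + 1) := by ring
      _ ≤ _ := by gcongr; exact le_max_right _ _
  · exact Filter.Eventually.of_forall fun x =>
      indicator_apply_nonneg fun _ => Real.rpow_nonneg (norm_nonneg _) _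

/-- The `-1` in `Phi` removes the zeroth term of the exponential series, leaving exactly the even
powers `2 * (k + 1)` that Young's inequality covers. -/
lemma ofReal_Phi_div_eq_tsum (t : ℝ) {l : ℝ} (hl : 0 < l) :
    ENNReal.ofReal (Phi (|t| / l)) =
      ∑' k : ℕ, ‖t‖ₑ ^ (2 * (k + 1)) *
        ENNReal.ofReal (1 / (l ^ (2 * (k + 1)) * (k + 1).factorial)) := by
  have hs : HasSum (fun k : ℕ => ((|t| / l) ^ 2) ^ (k + 1) / ((k + 1).factorial : ℝ))
      (Phi (|t| / l)) := by
    have h := NormedSpace.expSeries_div_hasSum_exp ((|t| / l) ^ 2)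
    rw [← Real.exp_eq_exp_ℝ] at h
    have h' := (hasSum_nat_add_iff' 1).2 h
    simpa [Phi] using h'
  rw [← hs.tsum_eq, ENNReal.ofReal_tsum_of_nonneg (fun _ => by positivity) hs.summable]
  congr 1
  ext k
  rw [← ofReal_norm, ← ENNReal.ofReal_pow (norm_nonneg _), ← ENNReal.ofReal_mul (by positivity),
    Real.norm_eq_abs]
  congr 1
  rw [← pow_mul, div_pow]
  field_simp

/-- Trudinger's exponential integrability of truncated Riesz potentials. -/
theorem exists_modular_le_one_of_le_riesz {R : ℝ} (hR : 1 ≤ R) :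
    ∃ c : ℝ, 0 < c ∧ ∀ (f : Plane → ℝ≥0∞) (w : Plane → ℝ) (Ω : Set Plane) (l : ℝ),
      AEMeasurable f → 0 < l →
      (∀ᵐ x ∂volume.restrict Ω, ‖w x‖ₑ ≤ (f ⋆ₗ rieszKernel R) x) →
      ∫⁻ x, f x ^ 2 ≤ ENNReal.ofReal (c * l ^ 2) → modular Phi Ω w l ≤ 1 := by
  obtain ⟨C, hC1, hC⟩ := lintegral_rieszKernel_rpow_le hR
  have hC0 : 0 < C := by linarith
  set D : ℝ := 2 * Real.exp 1 * C with hD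
  have hD1 : 1 ≤ D := by
    have := Real.add_one_le_exp (1 : ℝ)
    nlinarith
  have hD0 : 0 < D := by linarith
  clear_value D
  -- The `k`-th term of the series will be at most `D^(k+2) c^(k+1)`; this `c` makes it at most
  -- `2^(-(k+1))`, and these bounds sum to `1`.
  refine ⟨1 / (2 * D ^ 2), by positivity, fun f w Ω l hf hl hw hfl => ?_⟩
  set c : ℝ := 1 / (2 * D ^ 2) with hc
  have hc0 : 0 < c := by positivity
  have hconv : AEMeasurable (f ⋆ₗ rieszKernel R) :=
    aemeasurable_lconvolution hf (measurable_rieszKernel R).aemeasurable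
  have hterm : ∀ k : ℕ, (∫⁻ x, (f ⋆ₗ rieszKernel R) x ^ (2 * (k + 1))) *
      ENNReal.ofReal (1 / (l ^ (2 * (k + 1)) * (k + 1).factorial)) ≤
      ENNReal.ofReal ((1 / 2) ^ (k + 1)) := by
    intro k
    have h1 := lintegral_lconvolution_pow_le hf (measurable_rieszKernel R) (k := k + 1) (by simp)
    have h2 := hC (k + 1) (by simp)
    have h3 : (∫⁻ x, (f ⋆ₗ rieszKernel R) x ^ (2 * (k + 1))) ≤
        ENNReal.ofReal ((C * (k + 2)) ^ (k + 2) * (c * l ^ 2) ^ (k + 1)) := by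
      refine h1.trans ?_
      rw [ENNReal.ofReal_mul (by positivity), ENNReal.ofReal_pow (by positivity),
        ENNReal.ofReal_pow (by positivity)]
      refine mul_le_mul' (pow_le_pow_left' (h2.trans_eq ?_) _) (pow_le_pow_left' hfl _)
      congr 1
      push_cast; ring
    refine (mul_le_mul' h3 le_rfl).trans ?_
    rw [← ENNReal.ofReal_mul (by positivity)]
    apply ENNReal.ofReal_le_ofReal
    -- A crude Stirling bound: `n^n ≤ e^n n!` with `n = k + 2`. The factor `n` by which `n!` exceeds
    -- `(n-1)!` is absorbed by `2^n`.
    have h4 : ((k : ℝ) + 2) ^ (k + 2) ≤ (2 * Real.exp 1) ^ (k + 2) * (k + 1).factorial := by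
      have h5 := Real.pow_div_factorial_le_exp ((k + 2 : ℕ) : ℝ) (by positivity) (k + 2)
      rw [div_le_iff₀ (by positivity)] at h5
      have h6 : Real.exp ((k + 2 : ℕ) : ℝ) = Real.exp 1 ^ (k + 2) := by
        rw [← Real.exp_nat_mul]; simp
      rw [h6, Nat.factorial_succ (k + 1)] at h5
      have h7 : ((k + 2 : ℕ) : ℝ) ≤ 2 ^ (k + 2) := by
        exact_mod_cast (Nat.lt_two_pow_self (n := k + 2)).le
      push_cast at h5 h7
      calc ((k : ℝ) + 2) ^ (k + 2)
          ≤ Real.exp 1 ^ (k + 2) * ((k + 1 + 1) * (k + 1).factorial) := h5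
        _ ≤ Real.exp 1 ^ (k + 2) * (2 ^ (k + 2) * (k + 1).factorial) := by
            gcongr; linarith
        _ = _ := by rw [mul_pow]; ring
    calc (C * (k + 2)) ^ (k + 2) * (c * l ^ 2) ^ (k + 1) *
          (1 / (l ^ (2 * (k + 1)) * (k + 1).factorial))
        = C ^ (k + 2) * c ^ (k + 1) / (k + 1).factorial * ((k : ℝ) + 2) ^ (k + 2) := by
          rw [mul_pow, mul_pow, ← pow_mul]; field_simp
      _ ≤ C ^ (k + 2) * c ^ (k + 1) / (k + 1).factorial *
          ((2 * Real.exp 1) ^ (k + 2) * (k + 1).factorial) := by gcongr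
      _ = D ^ (k + 2) * c ^ (k + 1) := by
          rw [hD, mul_pow _ C]; field_simp
      _ = (1 / 2) ^ (k + 1) * (D / D ^ (k + 1)) := by
          rw [hc, one_div_pow, one_div_pow, mul_pow, ← pow_mul]
          field_simp
          ring
      _ ≤ (1 / 2) ^ (k + 1) * 1 := by
          gcongr
          rw [div_le_one (by positivity)]
          exact le_self_pow₀ hD1 (by simp)
      _ = _ := mul_one _
  calc modular Phi Ω w l
      = ∫⁻ x in Ω, ∑' k : ℕ, ‖w x‖ₑ ^ (2 * (k + 1)) *
        ENNReal.ofReal (1 / (l ^ (2 * (k + 1)) * (k + 1).factorial)) := by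
        unfold modular
        simp only [ofReal_Phi_div_eq_tsum _ hl]
    _ ≤ ∫⁻ x in Ω, ∑' k : ℕ, (f ⋆ₗ rieszKernel R) x ^ (2 * (k + 1)) *
        ENNReal.ofReal (1 / (l ^ (2 * (k + 1)) * (k + 1).factorial)) := by
        refine lintegral_mono_ae ?_
        filter_upwards [hw] with x hx
        gcongr
    _ ≤ ∫⁻ x, ∑' k : ℕ, (f ⋆ₗ rieszKernel R) x ^ (2 * (k + 1)) *
        ENNReal.ofReal (1 / (l ^ (2 * (k + 1)) * (k + 1).factorial)) := setLIntegral_le_lintegral _ _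
    _ = ∑' k : ℕ, (∫⁻ x, (f ⋆ₗ rieszKernel R) x ^ (2 * (k + 1))) *
        ENNReal.ofReal (1 / (l ^ (2 * (k + 1)) * (k + 1).factorial)) := by
        rw [lintegral_tsum fun k => (hconv.pow_const _).mul_const _]
        congr 1
        ext k
        rw [lintegral_mul_const'' _ (hconv.pow_const _)]
    _ ≤ ∑' k : ℕ, ENNReal.ofReal ((1 / 2) ^ (k + 1)) := ENNReal.tsum_le_tsum hterm
    _ = 1 := by
        rw [← ENNReal.ofReal_tsum_of_nonneg (fun _ => by positivity)]
        · simp only [pow_succ]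
          rw [tsum_mul_right, tsum_geometric_two]
          norm_num
        · exact (summable_nat_add_iff 1).2 summable_geometric_two

/-! ### The uniform cone condition. -/

/-- Every point of `S ∩ Ω` is the vertex of a round cone contained in `Ω`: the union of the
segments from the point to a ball of radius at least `b`, at distance at most `R`. -/
def ConeCondition (Ω S : Set Plane) (R b : ℝ) : Prop :=
  ∀ x ∈ S ∩ Ω, ∃ (p : Plane) (r : ℝ), b ≤ r ∧ ‖p‖ + r ≤ R ∧
    ∀ t ∈ Icc (0 : ℝ) 1, ∀ z ∈ Metric.closedBall p r, x + t • z ∈ Ω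

lemma ConeCondition.mono {Ω S T : Set Plane} {R R' b b' : ℝ} (h : ConeCondition Ω S R b)
    (hT : T ⊆ S) (hR : R ≤ R') (hb : b' ≤ b) : ConeCondition Ω T R' b' := by
  rintro x ⟨hx, hxΩ⟩
  obtain ⟨p, r, h1, h2, h3⟩ := h x ⟨hT hx, hxΩ⟩
  exact ⟨p, r, hb.trans h1, h2.trans hR, h3⟩

lemma coneCondition_ball {Ω : Set Plane} {x₀ : Plane} {δ : ℝ}
    (h : Metric.ball x₀ (2 * δ) ⊆ Ω) : ConeCondition Ω (Metric.ball x₀ δ) δ δ := by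
  rintro x ⟨hx, -⟩
  refine ⟨0, δ, le_rfl, by simp, fun t ht z hz => h ?_⟩
  rw [mem_closedBall_zero_iff] at hz
  rw [Metric.mem_ball, dist_eq_norm] at hx ⊢
  have : ‖t • z‖ ≤ δ := by
    rw [norm_smul, Real.norm_of_nonneg ht.1]
    nlinarith [ht.1, ht.2, norm_nonneg z]
  calc ‖x + t • z - x₀‖ = ‖(x - x₀) + t • z‖ := by congr 1; abel
    _ ≤ ‖x - x₀‖ + ‖t • z‖ := norm_add_le _ _
    _ < 2 * δ := by linarith

lemma abs_apply_le_norm (v : Plane) (i : Fin 2) : |v i| ≤ ‖v‖ := by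
  simpa using PiLp.norm_apply_le v i

/-- A smooth `γ` is Lipschitz, with constant `M`, near the base point. Directions whose vertical
component is at least `M` times the horizontal one never cross the graph from above, so a narrow
vertical cone fits at every point. -/
lemma coneCondition_above_graph {Ω : Set Plane} {x₀ : Plane} (L : Plane ≃ₗᵢ[ℝ] Plane)
    {γ : ℝ → ℝ} {ρ : ℝ} (hγ : ContDiff ℝ ∞ γ) (hρ : 0 < ρ)
    (hΩ : ∀ x ∈ Metric.ball x₀ ρ, (x ∈ Ω ↔ γ (L x 0) < L x 1)) :
    ∃ b, 0 < b ∧ ConeCondition Ω (Metric.ball x₀ (ρ / 2)) ρ b := by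
  obtain ⟨M, hM⟩ : ∃ M : ℝ≥0, LipschitzOnWith M γ (Metric.closedBall (L x₀ 0) ρ) :=
    (hγ.contDiffOn.of_le (by simp)).exists_lipschitzOnWith (n := 1) (by simp)
      (convex_closedBall _ _) (isCompact_closedBall _ _)
  -- The ball of radius `r` is centred at height `s = r(M+1)`. Its points have vertical component at
  -- least `s - r = M r` and horizontal component at most `r`; since `r + s = ρ/4`, the cone stays
  -- in the chart.
  set r : ℝ := ρ / (4 * (M + 2)) with hr
  have hM0 : (0 : ℝ) ≤ M := M.2
  have hr0 : 0 < r := by positivity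
  have hrρ : r * (M + 2) = ρ / 4 := by rw [hr]; field_simp
  set s : ℝ := r * (M + 1) with hs
  have hs0 : 0 ≤ s := by positivity
  set e : Plane := L.symm (EuclideanSpace.single 1 1) with he
  have hen : ‖e‖ = 1 := by simp [he]
  refine ⟨r, hr0, ?_⟩
  rintro x ⟨hx, hxΩ⟩
  refine ⟨s • e, r, le_rfl, ?_, fun t ht z hz => ?_⟩
  · rw [norm_smul, hen, Real.norm_of_nonneg hs0, hs]
    nlinarith
  rw [mem_closedBall_iff_norm] at hz
  have hznorm : ‖z‖ ≤ ρ / 4 := by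
    calc ‖z‖ = ‖(z - s • e) + s • e‖ := by rw [sub_add_cancel]
      _ ≤ ‖z - s • e‖ + ‖s • e‖ := norm_add_le _ _
      _ ≤ r + s := by
          rw [norm_smul, hen, Real.norm_of_nonneg hs0]; linarith
      _ = ρ / 4 := by rw [← hrρ, hs]; ring
  have htz : ‖t • z‖ ≤ ρ / 4 := by
    rw [norm_smul, Real.norm_of_nonneg ht.1]
    nlinarith [ht.1, ht.2, norm_nonneg z]
  rw [mem_ball_iff_norm] at hx
  have hxρ : x ∈ Metric.ball x₀ ρ := by rw [mem_ball_iff_norm]; linarith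
  have hx'norm : ‖x + t • z - x₀‖ < ρ := by
    calc ‖x + t • z - x₀‖ = ‖(x - x₀) + t • z‖ := by congr 1; abel
      _ ≤ ‖x - x₀‖ + ‖t • z‖ := norm_add_le _ _
      _ < ρ := by linarith
  have hx'ρ : x + t • z ∈ Metric.ball x₀ ρ := by rwa [mem_ball_iff_norm]
  rw [hΩ _ hx'ρ]
  have hxγ := (hΩ x hxρ).1 hxΩ
  have hmem : ∀ y : Plane, ‖y - x₀‖ < ρ → L y 0 ∈ Metric.closedBall (L x₀ 0) ρ := by
    intro y hy
    rw [Metric.mem_closedBall, Real.dist_eq]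
    have := abs_apply_le_norm (L (y - x₀)) 0
    rw [LinearIsometryEquiv.norm_map, map_sub] at this
    exact this.trans hy.le
  have hlip := hM.dist_le_mul _ (hmem _ hx'norm) _ (hmem x (by linarith))
  rw [Real.dist_eq, Real.dist_eq] at hlip
  have hw0 := abs_apply_le_norm (L (z - s • e)) 0
  have hw1 := abs_apply_le_norm (L (z - s • e)) 1
  rw [LinearIsometryEquiv.norm_map] at hw0 hw1
  have hLe : L e = EuclideanSpace.single 1 1 := by simp [he]
  simp only [map_sub, map_smul, hLe, PiLp.sub_apply, PiLp.smul_apply, PiLp.single_apply,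
    smul_eq_mul, map_add, PiLp.add_apply] at hw0 hw1 hlip ⊢
  simp at hw0 hw1 hlip
  rw [abs_of_nonneg ht.1] at hlip
  have h0 : |(L z) 0| ≤ r := hw0.trans hz
  have h1 : s - r ≤ (L z) 1 := by linarith [neg_abs_le ((L z) 1 - s), hw1.trans hz]
  have h2 : (M : ℝ) * (t * |(L z) 0|) ≤ t * (M * r) := by
    calc (M : ℝ) * (t * |(L z) 0|) ≤ M * (t * r) := by gcongr; exact ht.1
      _ = _ := by ring
  have h3 : t * (M * r) ≤ t * (L z) 1 := by
    refine mul_le_mul_of_nonneg_left ?_ ht.1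
    rw [hs] at h1; linarith
  linarith [le_abs_self (γ (L x 0 + t * (L z) 0) - γ (L x 0))]

/-- The condition survives finite unions (larger `R`, smaller `b`), so compactness of the closure
makes local constants global. Working on the closure is what brings the boundary charts into the
cover. -/
theorem exists_coneCondition {Ω : Set Plane} (hΩ : IsSmoothBoundedDomain Ω ∨ Ω = univ) :
    ∃ R b : ℝ, 1 ≤ R ∧ 0 < b ∧ ConeCondition Ω univ R b := by
  suffices ∃ R b : ℝ, 0 < b ∧ ConeCondition Ω (closure Ω) R b by
    obtain ⟨R, b, hb, h⟩ := this
    refine ⟨max R 1, b, le_max_right _ _, hb, fun x hx => ?_⟩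
    exact h.mono le_rfl (le_max_left _ _) le_rfl x ⟨subset_closure hx.2, hx.2⟩
  rcases hΩ with hΩ | rfl
  · refine (hΩ.isBounded.isCompact_closure).induction_on
      (p := fun S => ∃ R b : ℝ, 0 < b ∧ ConeCondition Ω S R b) ?_ ?_ ?_ ?_
    · exact ⟨0, 1, one_pos, fun x hx => absurd hx.1 (notMem_empty x)⟩
    · rintro S T hST ⟨R, b, hb, h⟩
      exact ⟨R, b, hb, h.mono hST le_rfl le_rfl⟩
    · rintro S T ⟨R, b, hb, h⟩ ⟨R', b', hb', h'⟩
      refine ⟨max R R', min b b', lt_min hb hb', ?_⟩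
      rintro x ⟨hx | hx, hxΩ⟩
      · exact h.mono le_rfl (le_max_left _ _) (min_le_left _ _) x ⟨hx, hxΩ⟩
      · exact h'.mono le_rfl (le_max_right _ _) (min_le_right _ _) x ⟨hx, hxΩ⟩
    · intro x hx
      by_cases hxΩ : x ∈ Ω
      · obtain ⟨δ, hδ, h⟩ := Metric.isOpen_iff.1 hΩ.isOpen x hxΩ
        refine ⟨Metric.ball x (δ / 2), mem_nhdsWithin_of_mem_nhds
          (Metric.ball_mem_nhds _ (by positivity)), δ / 2, δ / 2, by positivity, ?_⟩
        apply coneCondition_ball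
        rwa [mul_div_cancel₀ _ two_ne_zero]
      · obtain ⟨L, γ, ρ, hγ, hρ, h⟩ := hΩ.smooth_boundary x
          (by rw [frontier, hΩ.isOpen.interior_eq]; exact ⟨hx, hxΩ⟩)
        obtain ⟨b, hb, h'⟩ := coneCondition_above_graph L hγ hρ h
        exact ⟨Metric.ball x (ρ / 2), mem_nhdsWithin_of_mem_nhds
          (Metric.ball_mem_nhds _ (by positivity)), ρ, b, hb, h'⟩
  · exact ⟨1, 1, one_pos, fun x _ => ⟨0, 1, le_rfl, by simp, fun _ _ _ _ => mem_univ _⟩⟩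

/-! ### Pointwise bound of a `C¹` function by a Riesz potential. -/

lemma rieszKernel_neg (R : ℝ) (y : Plane) : rieszKernel R (-y) = rieszKernel R y := by
  simp [rieszKernel, indicator]

lemma lconvolution_rieszKernel_apply (h : Plane → ℝ≥0∞) (R : ℝ) (x : Plane) :
    (h ⋆ₗ rieszKernel R) x = ∫⁻ z, h (x + z) * rieszKernel R z := by
  rw [lconvolution_def, ← lintegral_add_left_eq_self _ x]
  simp only [neg_add_rev, neg_add_cancel_right, rieszKernel_neg]

lemma lintegral_comp_smul_plane {h : Plane → ℝ≥0∞} (hh : Measurable h) {t : ℝ} (ht : 0 < t) :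
    ∫⁻ z, h (t • z) = ENNReal.ofReal ((t ^ 2)⁻¹) * ∫⁻ y, h y := by
  rw [← lintegral_map (μ := (volume : Measure Plane)) hh (measurable_const_smul t),
    Measure.map_addHaar_smul _ ht.ne', lintegral_smul_measure]
  simp

/-- On this ball `1 ≤ R / |z|`. -/
lemma setLIntegral_closedBall_le_riesz (h : Plane → ℝ≥0∞) {R : ℝ} (hR : 0 < R) (x : Plane) :
    ∫⁻ z in Metric.closedBall 0 R, h (x + z) ≤
      ENNReal.ofReal R * (h ⋆ₗ rieszKernel R) x := by
  rw [lconvolution_rieszKernel_apply, ← lintegral_indicator Metric.isClosed_closedBall.measurableSet,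
    ← lintegral_const_mul' _ _ ENNReal.ofReal_ne_top]
  refine lintegral_mono fun z => ?_
  by_cases hz : z ∈ Metric.closedBall (0 : Plane) R
  · rw [indicator_of_mem hz, rieszKernel, indicator_of_mem hz]
    have hz' : ‖z‖ₑ ≤ ENNReal.ofReal R := by
      rw [← ofReal_norm]
      exact ENNReal.ofReal_le_ofReal (by simpa using hz)
    have h1 : 1 ≤ ENNReal.ofReal R * ‖z‖ₑ⁻¹ := by
      rw [← div_eq_mul_inv]
      by_cases h0 : z = 0
      · simp [h0, ENNReal.div_zero, hR]
      · rw [ENNReal.le_div_iff_mul_le (Or.inl (by simpa using h0)) (Or.inl (by simp))]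
        simpa using hz'
    calc h (x + z) = h (x + z) * 1 := (mul_one _).symm
      _ ≤ h (x + z) * (ENNReal.ofReal R * ‖z‖ₑ⁻¹) := by gcongr
      _ = _ := by ring
  · rw [indicator_of_notMem hz]
    exact zero_le

/-- The indicator requires `t ≥ |y|/R`, and the integral of `t^(-2)` over `t ≥ |y|/R` is `R/|y|`.
This is how the Riesz kernel arises from averaging over segments. -/
lemma lintegral_cone_kernel_le {R : ℝ} (hR : 0 < R) (y : Plane) :
    ∫⁻ t in Ioc (0 : ℝ) 1, (Metric.closedBall (0 : Plane) (t * R)).indicator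
        (fun _ => ENNReal.ofReal ((t ^ 2)⁻¹)) y ≤ ENNReal.ofReal R * rieszKernel R y := by
  by_cases hyR : y ∈ Metric.closedBall (0 : Plane) R
  swap
  · refine (le_of_eq ?_).trans zero_le
    rw [setLIntegral_congr_fun measurableSet_Ioc (g := fun _ => 0)]
    · simp
    · intro t ht
      refine indicator_of_notMem (fun hy => hyR ?_) _
      exact Metric.closedBall_subset_closedBall (by nlinarith [ht.2]) hy
  rw [rieszKernel, indicator_of_mem hyR]
  by_cases h0 : y = 0
  · simp [h0, ENNReal.mul_top, hR]
  have hy : 0 < ‖y‖ := norm_pos_iff.2 h0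
  set a : ℝ := ‖y‖ / R with ha
  have ha0 : 0 < a := by positivity
  have hint : IntegrableOn (fun t : ℝ => t ^ (-2 : ℝ)) (Ioi a) :=
    integrableOn_Ioi_rpow_of_lt (by norm_num) ha0
  have hval : ∫⁻ t in Ioi a, ENNReal.ofReal (t ^ (-2 : ℝ)) = ENNReal.ofReal R * ‖y‖ₑ⁻¹ := by
    rw [← ofReal_integral_eq_lintegral_ofReal hint, integral_Ioi_rpow_of_lt (by norm_num) ha0,
      ← ofReal_norm, ← ENNReal.ofReal_inv_of_pos hy, ← ENNReal.ofReal_mul hR.le]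
    · congr 1
      norm_num
      rw [Real.rpow_neg_one, ha]
      field_simp
    · filter_upwards [ae_restrict_mem measurableSet_Ioi] with t ht
      exact Real.rpow_nonneg (ha0.le.trans (le_of_lt ht)) _
  rw [← hval, ← setLIntegral_congr Ioi_ae_eq_Ici.symm,
    ← lintegral_indicator measurableSet_Ioc, ← lintegral_indicator measurableSet_Ici]
  refine lintegral_mono fun t => ?_
  by_cases ht : t ∈ Ioc (0 : ℝ) 1
  · rw [indicator_of_mem ht]
    by_cases hyt : y ∈ Metric.closedBall (0 : Plane) (t * R)
    · have : t ∈ Ici a := by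
        rw [mem_closedBall_zero_iff] at hyt
        rw [mem_Ici, ha, div_le_iff₀ hR]
        exact hyt
      rw [indicator_of_mem hyt, indicator_of_mem this, Real.rpow_neg ht.1.le]
      norm_cast
    · rw [indicator_of_notMem hyt]
      exact zero_le
  · rw [indicator_of_notMem ht]
    exact zero_le

/-- The substitution `y = t z` has Jacobian `t^(-2)` in the plane; Tonelli then leaves the
`t`-integral of `lintegral_cone_kernel_le`. -/
lemma lintegral_segments_le_riesz {h : Plane → ℝ≥0∞} (hh : Measurable h) {R : ℝ} (hR : 0 < R)
    (x : Plane) :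
    ∫⁻ t in Ioc (0 : ℝ) 1, ∫⁻ z in Metric.closedBall 0 R, h (x + t • z) ≤
      ENNReal.ofReal R * (h ⋆ₗ rieszKernel R) x := by
  have hscale : ∀ t ∈ Ioc (0 : ℝ) 1, ∫⁻ z in Metric.closedBall 0 R, h (x + t • z) =
      ∫⁻ y, h (x + y) * (Metric.closedBall (0 : Plane) (t * R)).indicator
        (fun _ => ENNReal.ofReal ((t ^ 2)⁻¹)) y := by
    intro t ht
    have hm : Measurable ((Metric.closedBall (0 : Plane) (t * R)).indicator fun y => h (x + y)) :=
      (hh.comp (measurable_const_add x)).indicator Metric.isClosed_closedBall.measurableSet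
    calc ∫⁻ z in Metric.closedBall 0 R, h (x + t • z)
        = ∫⁻ z, (Metric.closedBall (0 : Plane) (t * R)).indicator (fun y => h (x + y)) (t • z) := by
          rw [← lintegral_indicator Metric.isClosed_closedBall.measurableSet]
          congr 1
          ext z
          have : z ∈ Metric.closedBall (0 : Plane) R ↔
              t • z ∈ Metric.closedBall (0 : Plane) (t * R) := by
            rw [mem_closedBall_zero_iff, mem_closedBall_zero_iff, norm_smul,
              Real.norm_of_nonneg ht.1.le, mul_le_mul_iff_right₀ ht.1]
          by_cases hz : z ∈ Metric.closedBall (0 : Plane) R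
          · rw [indicator_of_mem hz, indicator_of_mem (this.1 hz)]
          · rw [indicator_of_notMem hz, indicator_of_notMem (fun h' => hz (this.2 h'))]
      _ = _ := by
          rw [lintegral_comp_smul_plane hm ht.1, ← lintegral_const_mul' _ _ ENNReal.ofReal_ne_top]
          congr 1
          ext y
          by_cases hy : y ∈ Metric.closedBall (0 : Plane) (t * R)
          · simp only [indicator_of_mem hy]; ring
          · simp only [indicator_of_notMem hy, mul_zero]
  rw [setLIntegral_congr_fun measurableSet_Ioc hscale, lintegral_lintegral_swap]
  · rw [lconvolution_rieszKernel_apply, ← lintegral_const_mul' _ _ ENNReal.ofReal_ne_top]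
    refine lintegral_mono fun y => ?_
    have hm : Measurable fun t : ℝ => (Metric.closedBall (0 : Plane) (t * R)).indicator
        (fun _ => ENNReal.ofReal ((t ^ 2)⁻¹)) y := by
      have : (fun t : ℝ => (Metric.closedBall (0 : Plane) (t * R)).indicator
          (fun _ => ENNReal.ofReal ((t ^ 2)⁻¹)) y) =
          {t : ℝ | ‖y‖ ≤ t * R}.indicator fun t => ENNReal.ofReal ((t ^ 2)⁻¹) := by
        ext t; simp [indicator]
      rw [this]
      exact Measurable.indicator (by fun_prop)
        (measurableSet_le measurable_const (by fun_prop))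
    show ∫⁻ t in Ioc (0 : ℝ) 1, h (x + y) * _ ≤ _
    rw [lintegral_const_mul _ hm]
    calc _ ≤ h (x + y) * (ENNReal.ofReal R * rieszKernel R y) := by
          gcongr; exact lintegral_cone_kernel_le hR y
      _ = _ := by ring
  · refine Measurable.aemeasurable ?_
    refine Measurable.mul (by fun_prop) ?_
    have : (fun q : ℝ × Plane => (Metric.closedBall (0 : Plane) (q.1 * R)).indicator
        (fun _ => ENNReal.ofReal ((q.1 ^ 2)⁻¹)) q.2) =
        {q : ℝ × Plane | ‖q.2‖ ≤ q.1 * R}.indicator fun q => ENNReal.ofReal ((q.1 ^ 2)⁻¹) := by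
      ext q; simp [indicator]
    rw [this]
    exact Measurable.indicator (by fun_prop) (measurableSet_le (by fun_prop) (by fun_prop))

lemma enorm_le_add_lintegral_segment {w : Plane → ℝ} (hw : ContDiff ℝ 1 w) (x z : Plane) :
    ‖w x‖ₑ ≤ ‖w (x + z)‖ₑ + ∫⁻ t in Ioc (0 : ℝ) 1, ‖fderiv ℝ w (x + t • z) z‖ₑ := by
  have hderiv : ∀ t : ℝ, HasDerivAt (fun t : ℝ => w (x + t • z)) (fderiv ℝ w (x + t • z) z) t := by
    intro t
    have h1 : HasDerivAt (fun t : ℝ => x + t • z) z t := by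
      simpa using ((hasDerivAt_id t).smul_const z).const_add x
    exact ((hw.differentiable one_ne_zero _).hasFDerivAt).comp_hasDerivAt t h1
  have hcont : Continuous fun t : ℝ => fderiv ℝ w (x + t • z) z :=
    ((hw.continuous_fderiv one_ne_zero).comp (by fun_prop)).clm_apply continuous_const
  have hftc := intervalIntegral.integral_eq_sub_of_hasDerivAt (fun t _ => hderiv t)
    (hcont.intervalIntegrable 0 1)
  rw [intervalIntegral.integral_of_le zero_le_one] at hftc
  simp only [one_smul, zero_smul, add_zero] at hftc
  have : w x = w (x + z) - ∫ t in Ioc (0 : ℝ) 1, fderiv ℝ w (x + t • z) z := by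
    rw [hftc]; ring
  calc ‖w x‖ₑ ≤ ‖w (x + z)‖ₑ + ‖∫ t in Ioc (0 : ℝ) 1, fderiv ℝ w (x + t • z) z‖ₑ := by
        rw [this]; exact enorm_sub_le
    _ ≤ _ := by gcongr; exact enorm_integral_le_lintegral_enorm _

/-- The fundamental theorem of calculus along the segment from `x` to `x + z` is integrated over `z`
in the base ball of the cone. Once `w` and its derivative are replaced by `h`, the base may be
enlarged to the centred ball of radius `R`, even if that leaves the cone. The endpoint term
contributes `R` and the derivative term `R²`. -/
lemma enorm_le_riesz_of_cone {w : Plane → ℝ} (hw : ContDiff ℝ 1 w) {h : Plane → ℝ≥0∞}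
    (hh : Measurable h) {x p : Plane} {r R b : ℝ} (hb : 0 < b) (hbr : b ≤ r) (hpr : ‖p‖ + r ≤ R)
    (hcone : ∀ t ∈ Icc (0 : ℝ) 1, ∀ z ∈ Metric.closedBall p r,
      ‖w (x + t • z)‖ₑ ≤ h (x + t • z) ∧
        ∀ v, ‖fderiv ℝ w (x + t • z) v‖ₑ ≤ h (x + t • z) * ‖v‖ₑ) :
    volume (Metric.closedBall (0 : Plane) b) * ‖w x‖ₑ ≤
      ENNReal.ofReal (R + R ^ 2) * (h ⋆ₗ rieszKernel R) x := by
  have hR : 0 < R := by linarith [norm_nonneg p]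
  have hsub : Metric.closedBall p r ⊆ Metric.closedBall 0 R := by
    apply Metric.closedBall_subset_closedBall'
    rw [dist_zero_right]; linarith
  have hpt : ∀ z ∈ Metric.closedBall p r, ‖w x‖ₑ ≤
      h (x + z) + ∫⁻ t in Ioc (0 : ℝ) 1, h (x + t • z) * ENNReal.ofReal R := by
    intro z hz
    refine (enorm_le_add_lintegral_segment hw x z).trans (add_le_add ?_ ?_)
    · simpa using (hcone 1 (by simp) z hz).1
    · refine setLIntegral_mono' measurableSet_Ioc fun t ht => ?_
      refine ((hcone t (Ioc_subset_Icc_self ht) z hz).2 z).trans ?_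
      gcongr
      rw [← ofReal_norm]
      exact ENNReal.ofReal_le_ofReal (by simpa using hsub hz)
  have hm : Measurable (Function.uncurry fun (z : Plane) (t : ℝ) => h (x + t • z)) := by
    fun_prop
  calc volume (Metric.closedBall (0 : Plane) b) * ‖w x‖ₑ
      ≤ volume (Metric.closedBall p r) * ‖w x‖ₑ := by
        refine mul_le_mul' ?_ le_rfl
        rw [← Measure.addHaar_closedBall_center volume p b]
        exact measure_mono (Metric.closedBall_subset_closedBall hbr)
    _ = ∫⁻ _ in Metric.closedBall p r, ‖w x‖ₑ := by rw [setLIntegral_const, mul_comm]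
    _ ≤ ∫⁻ z in Metric.closedBall p r,
          (h (x + z) + ∫⁻ t in Ioc (0 : ℝ) 1, h (x + t • z) * ENNReal.ofReal R) :=
        setLIntegral_mono' Metric.isClosed_closedBall.measurableSet hpt
    _ ≤ ∫⁻ z in Metric.closedBall 0 R,
          (h (x + z) + ∫⁻ t in Ioc (0 : ℝ) 1, h (x + t • z) * ENNReal.ofReal R) :=
        lintegral_mono_set hsub
    _ = (∫⁻ z in Metric.closedBall 0 R, h (x + z)) +
          ∫⁻ t in Ioc (0 : ℝ) 1, (∫⁻ z in Metric.closedBall 0 R, h (x + t • z)) *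
            ENNReal.ofReal R := by
        rw [lintegral_add_left (by fun_prop), lintegral_lintegral_swap]
        · congr 1
          refine lintegral_congr fun t => ?_
          rw [lintegral_mul_const' _ _ ENNReal.ofReal_ne_top]
        · exact (hm.mul_const _).aemeasurable
    _ ≤ ENNReal.ofReal R * (h ⋆ₗ rieszKernel R) x +
          ENNReal.ofReal R * (h ⋆ₗ rieszKernel R) x * ENNReal.ofReal R := by
        rw [lintegral_mul_const' _ _ ENNReal.ofReal_ne_top]
        gcongr
        · exact setLIntegral_closedBall_le_riesz h hR x
        · exact lintegral_segments_le_riesz hh hR x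
    _ = _ := by
        rw [ENNReal.ofReal_add hR.le (by positivity), pow_two, ENNReal.ofReal_mul hR.le]
        ring

end OrliczPlane

namespace OrliczPlane

open scoped ENNReal NNReal Topology Convolution
open Filter ContinuousLinearMap

/-! ### Mollification, and the pointwise bound for Sobolev functions. -/

lemma fderiv_comp_const_sub_apply {ρ : Plane → ℝ} (hρ : Differentiable ℝ ρ) (y t v : Plane) :
    fderiv ℝ (fun z => ρ (y - z)) t v = -fderiv ℝ ρ (y - t) v := by
  have h1 : HasFDerivAt (fun z : Plane => y - z) (-ContinuousLinearMap.id ℝ Plane) t :=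
    (hasFDerivAt_id t).const_sub y
  have h2 := (hρ (y - t)).hasFDerivAt.comp t h1
  rw [show (fun z => ρ (y - z)) = ρ ∘ fun z => y - z from rfl, h2.fderiv]
  simp

lemma isTestFunction_comp_const_sub {Ω : Set Plane} {ρ : Plane → ℝ} (hρ : ContDiff ℝ ∞ ρ)
    {δ : ℝ} (hsupp : tsupport ρ ⊆ Metric.closedBall 0 δ) {y : Plane}
    (hy : Metric.closedBall y δ ⊆ Ω) : IsTestFunction Ω (fun z => ρ (y - z)) := by
  have hts : tsupport (fun z => ρ (y - z)) ⊆ Metric.closedBall y δ := by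
    refine closure_minimal (fun z hz => ?_) Metric.isClosed_closedBall
    have := hsupp (subset_tsupport ρ hz)
    rw [mem_closedBall_zero_iff] at this
    rwa [Metric.mem_closedBall, dist_comm, dist_eq_norm]
  exact ⟨by fun_prop, HasCompactSupport.of_support_subset_isCompact (isCompact_closedBall y δ)
    ((subset_tsupport _).trans hts), hts.trans hy⟩

/-- The zero extension of `u` need not have a weak gradient across the boundary. When the `δ`-ball
about `y` lies in `Ω`, however, `z ↦ ρ (y - z)` is a test function on `Ω`, and the sign from the
reflection cancels the one from integration by parts. -/
lemma fderiv_convolution_eq {Ω : Set Plane} (hΩ : MeasurableSet Ω) {u : Plane → ℝ}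
    {G : Plane → Plane} (hU : LocallyIntegrable (Ω.indicator u)) (hG : IsWeakGradient Ω u G)
    {ρ : Plane → ℝ} (hρ : ContDiff ℝ ∞ ρ) (hρc : HasCompactSupport ρ) {δ : ℝ}
    (hsupp : tsupport ρ ⊆ Metric.closedBall 0 δ) {y : Plane} (hy : Metric.closedBall y δ ⊆ Ω)
    (i : Fin 2) :
    fderiv ℝ (ρ ⋆[lsmul ℝ ℝ, volume] Ω.indicator u) y (EuclideanSpace.single i 1) =
      ∫ z in Ω, G z i * ρ (y - z) := by
  have hρ1 : ContDiff ℝ 1 ρ := hρ.of_le (by simp)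
  set e : Plane := EuclideanSpace.single i 1
  rw [(hρc.hasFDerivAt_convolution_left (lsmul ℝ ℝ) hρ1 hU y).fderiv, convolution_eq_swap]
  have hex := ((hρc.fderiv ℝ).convolutionExists_left ((lsmul ℝ ℝ).precompL Plane)
    (hρ1.continuous_fderiv one_ne_zero) hU y).integrable_swap
  rw [ContinuousLinearMap.integral_apply hex]
  have hweak := hG.2.2 _ (isTestFunction_comp_const_sub hρ hsupp hy) i
  simp only [fderiv_comp_const_sub_apply (hρ1.differentiable one_ne_zero), mul_neg,
    integral_neg, neg_inj] at hweak
  rw [← hweak, ← integral_indicator hΩ]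
  congr 1
  ext t
  simp only [precompL_apply, lsmul_apply, smul_eq_mul]
  by_cases ht : t ∈ Ω
  · simp only [indicator_of_mem ht]; exact mul_comm _ _
  · simp [indicator_of_notMem ht]

lemma enorm_fderiv_apply_le {w : Plane → ℝ} {y : Plane} {c : ℝ≥0∞}
    (h : ∀ i : Fin 2, ‖fderiv ℝ w y (EuclideanSpace.single i 1)‖ₑ ≤ c) (v : Plane) :
    ‖fderiv ℝ w y v‖ₑ ≤ 2 * c * ‖v‖ₑ := by
  have hv : v = ∑ i : Fin 2, v i • (EuclideanSpace.single i (1 : ℝ) : Plane) := by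
    ext j
    fin_cases j <;> simp
  have hvi : ∀ i, ‖v i‖ₑ ≤ ‖v‖ₑ := fun i => by
    rw [← ofReal_norm, ← ofReal_norm]
    exact ENNReal.ofReal_le_ofReal (PiLp.norm_apply_le v i)
  conv_lhs => rw [hv]
  rw [map_sum]
  refine (enorm_sum_le _ _).trans ?_
  calc ∑ i : Fin 2, ‖fderiv ℝ w y (v i • EuclideanSpace.single i (1 : ℝ))‖ₑ
      ≤ ∑ _i : Fin 2, ‖v‖ₑ * c := by
        refine Finset.sum_le_sum fun i _ => ?_
        rw [map_smul, smul_eq_mul, enorm_mul]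
        exact mul_le_mul' (hvi i) (h i)
    _ = _ := by simp; ring

lemma enorm_convolution_le (ρ U : Plane → ℝ) (y : Plane) :
    ‖(ρ ⋆[lsmul ℝ ℝ, volume] U) y‖ₑ ≤ ((fun z => ‖ρ z‖ₑ) ⋆ₗ fun z => ‖U z‖ₑ) y := by
  rw [convolution_def, lconvolution_def]
  refine (enorm_integral_le_lintegral_enorm _).trans_eq ?_
  refine lintegral_congr fun t => ?_
  rw [lsmul_apply, smul_eq_mul, enorm_mul, neg_add_eq_sub]

lemma lconvolution_congr_right {f g h : Plane → ℝ≥0∞} (hgh : g =ᵐ[volume] h) :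
    f ⋆ₗ g = f ⋆ₗ h := by
  ext x
  rw [lconvolution_def, lconvolution_def]
  refine lintegral_congr_ae ?_
  filter_upwards [(quasiMeasurePreserving_sub_left (volume : Measure Plane) x).ae hgh] with t ht
  rw [neg_add_eq_sub, ht]

lemma lconvolution_congr_left {f g h : Plane → ℝ≥0∞} (hgh : g =ᵐ[volume] h) :
    g ⋆ₗ f = h ⋆ₗ f := by
  ext x
  rw [lconvolution_def, lconvolution_def]
  refine lintegral_congr_ae ?_
  filter_upwards [hgh] with t ht
  rw [ht]

lemma lconvolution_mono_right {f g h : Plane → ℝ≥0∞} (hgh : g ≤ h) : f ⋆ₗ g ≤ f ⋆ₗ h :=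
  fun _ => lintegral_mono fun _ => mul_le_mul' le_rfl (hgh _)

lemma enorm_fderiv_convolution_le {Ω : Set Plane} (hΩ : MeasurableSet Ω) {u : Plane → ℝ}
    {G : Plane → Plane} (hU : LocallyIntegrable (Ω.indicator u)) (hG : IsWeakGradient Ω u G)
    {ρ : Plane → ℝ} (hρ : ContDiff ℝ ∞ ρ) (hρc : HasCompactSupport ρ) {δ : ℝ}
    (hsupp : tsupport ρ ⊆ Metric.closedBall 0 δ) {y : Plane} (hy : Metric.closedBall y δ ⊆ Ω)
    (v : Plane) :
    ‖fderiv ℝ (ρ ⋆[lsmul ℝ ℝ, volume] Ω.indicator u) y v‖ₑ ≤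
      2 * ((fun z => ‖ρ z‖ₑ) ⋆ₗ Ω.indicator fun z => ‖G z‖ₑ) y * ‖v‖ₑ := by
  refine enorm_fderiv_apply_le (fun i => ?_) v
  rw [fderiv_convolution_eq hΩ hU hG hρ hρc hsupp hy i, lconvolution_comm, lconvolution_def,
    ← integral_indicator hΩ]
  refine (enorm_integral_le_lintegral_enorm _).trans (lintegral_mono fun z => ?_)
  by_cases hz : z ∈ Ω
  · rw [indicator_of_mem hz, indicator_of_mem hz, enorm_mul, neg_add_eq_sub]
    gcongr
    rw [← ofReal_norm, ← ofReal_norm]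
    exact ENNReal.ofReal_le_ofReal (PiLp.norm_apply_le _ i)
  · rw [indicator_of_notMem hz]
    simp

lemma memLp_toReal_of_lintegral_sq_ne_top {F : Plane → ℝ≥0∞} (hF : Measurable F)
    (h : ∫⁻ x, F x ^ 2 ≠ ⊤) : MemLp (fun x => (F x).toReal) 2 := by
  rw [memLp_two_iff_integrable_sq hF.ennreal_toReal.aestronglyMeasurable]
  refine ⟨(hF.ennreal_toReal.pow_const 2).aestronglyMeasurable,
    lt_of_le_of_lt (lintegral_mono fun x => ?_) h.lt_top⟩
  show ‖(F x).toReal ^ 2‖ₑ ≤ _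
  rw [← ENNReal.toReal_pow, Real.enorm_eq_ofReal ENNReal.toReal_nonneg]
  exact ENNReal.ofReal_toReal_le

lemma ofReal_convolution_toReal {ρ : Plane → ℝ} (hρ : Continuous ρ) (hρc : HasCompactSupport ρ)
    (hρ0 : ∀ x, 0 ≤ ρ x) {F : Plane → ℝ≥0∞} (hF : ∀ᵐ x, F x < ⊤)
    (hFi : LocallyIntegrable fun x => (F x).toReal) (x : Plane) :
    ENNReal.ofReal ((ρ ⋆[lsmul ℝ ℝ, volume] fun x => (F x).toReal) x) =
      ((fun z => ‖ρ z‖ₑ) ⋆ₗ F) x := by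
  have hint := (hρc.convolutionExists_left (lsmul ℝ ℝ) hρ hFi x).integrable
  rw [convolution_def, ofReal_integral_eq_lintegral_ofReal hint, lconvolution_def]
  · refine lintegral_congr_ae ?_
    filter_upwards [(quasiMeasurePreserving_sub_left (volume : Measure Plane) x).ae hF] with t ht
    rw [lsmul_apply, smul_eq_mul, ENNReal.ofReal_mul (hρ0 t), ENNReal.ofReal_toReal ht.ne,
      neg_add_eq_sub, Real.enorm_eq_ofReal (hρ0 t)]
  · exact Eventually.of_forall fun t => mul_nonneg (hρ0 t) ENNReal.toReal_nonneg

/-- Young's inequality with `k = 1`, hence `r = 1`. It makes the potential finite almost everywhere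
and locally integrable, so that it can itself be mollified. -/
lemma lintegral_riesz_sq_ne_top {f : Plane → ℝ≥0∞} (hf : AEMeasurable f) {R : ℝ} (hR : 1 ≤ R)
    (h : ∫⁻ x, f x ^ 2 ≠ ⊤) : ∫⁻ x, (f ⋆ₗ rieszKernel R) x ^ 2 ≠ ⊤ := by
  obtain ⟨C, -, hC⟩ := lintegral_rieszKernel_rpow_le hR
  have h1 := lintegral_lconvolution_pow_le hf (measurable_rieszKernel R) (k := 1) le_rfl
  refine ne_top_of_le_ne_top ?_ h1
  exact ENNReal.mul_ne_top (ENNReal.pow_ne_top (ne_top_of_le_ne_top ENNReal.ofReal_ne_top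
    (hC 1 le_rfl))) (ENNReal.pow_ne_top h)

/-- The mollifiers used to regularize Sobolev functions. -/
noncomputable def mollifierBump (n : ℕ) : ContDiffBump (0 : Plane) where
  rIn := 1 / (2 * (n + 1))
  rOut := 1 / (n + 1)
  rIn_pos := by positivity
  rIn_lt_rOut := by
    apply one_div_lt_one_div_of_lt <;> [positivity; nlinarith [(Nat.cast_nonneg n : (0 : ℝ) ≤ n)]]

lemma tendsto_mollifierBump_rOut : Tendsto (fun n => (mollifierBump n).rOut) atTop (𝓝 0) :=
  tendsto_one_div_add_atTop_nhds_zero_nat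

lemma ae_tendsto_mollifierBump {g : Plane → ℝ} (hg : LocallyIntegrable g) :
    ∀ᵐ x, Tendsto (fun n => ((mollifierBump n).normed volume ⋆[lsmul ℝ ℝ, volume] g) x) atTop
      (𝓝 (g x)) := by
  -- `K = 2` is the fixed ratio of the outer to the inner radius of the bumps.
  refine ContDiffBump.ae_convolution_tendsto_right_of_locallyIntegrable (K := 2)
    tendsto_mollifierBump_rOut (Eventually.of_forall fun n => ?_) hg
  simp only [mollifierBump]
  apply le_of_eq
  field_simp

/-- The cone is a compact subset of the open set `Ω`, so it keeps a positive distance from the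
complement. -/
lemma eventually_cone_subset {Ω : Set Plane} (hΩ : IsOpen Ω) {x p : Plane} {r : ℝ}
    (h : ∀ t ∈ Icc (0 : ℝ) 1, ∀ z ∈ Metric.closedBall p r, x + t • z ∈ Ω) :
    ∀ᶠ n in atTop, ∀ t ∈ Icc (0 : ℝ) 1, ∀ z ∈ Metric.closedBall p r,
      Metric.closedBall (x + t • z) (mollifierBump n).rOut ⊆ Ω := by
  set K : Set Plane := (fun q : ℝ × Plane => x + q.1 • q.2) '' (Icc 0 1 ×ˢ Metric.closedBall p r)
  have hK : IsCompact K := (isCompact_Icc.prod (isCompact_closedBall p r)).image (by fun_prop)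
  have hKΩ : K ⊆ Ω := by
    rintro _ ⟨⟨t, z⟩, ⟨ht, hz⟩, rfl⟩
    exact h t ht z hz
  obtain ⟨δ, hδ, hKδ⟩ := hK.exists_cthickening_subset_open hΩ hKΩ
  filter_upwards [tendsto_mollifierBump_rOut.eventually_lt_const hδ] with n hn t ht z hz
  have hmem : x + t • z ∈ K := ⟨(t, z), ⟨ht, hz⟩, rfl⟩
  exact ((Metric.closedBall_subset_closedBall hn.le).trans
    (Metric.closedBall_subset_cthickening hmem δ)).trans hKδ

lemma const_mul_lconvolution (c : ℝ≥0∞) (hc : c ≠ ⊤) (f g : Plane → ℝ≥0∞) (x : Plane) :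
    ((fun y => c * f y) ⋆ₗ g) x = c * (f ⋆ₗ g) x := by
  simp only [lconvolution_def, mul_assoc]
  rw [lintegral_const_mul' _ _ hc]

/-- The sum `|u| + |G|`, extended by zero outside `Ω`. -/
noncomputable def sobolevDensity (Ω : Set Plane) (u : Plane → ℝ) (G : Plane → Plane) :
    Plane → ℝ≥0∞ :=
  Ω.indicator fun x => ‖u x‖ₑ + ‖G x‖ₑ

lemma aemeasurable_sobolevDensity {Ω : Set Plane} (hΩ : MeasurableSet Ω) {u : Plane → ℝ}
    {G : Plane → Plane} (hu : MemLp u 2 (volume.restrict Ω)) (hG : MemLp G 2 (volume.restrict Ω)) :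
    AEMeasurable (sobolevDensity Ω u G) :=
  (aemeasurable_indicator_iff hΩ).2
    (hu.aestronglyMeasurable.enorm.add hG.aestronglyMeasurable.enorm)

lemma lintegral_sobolevDensity_sq_le {Ω : Set Plane} (hΩ : MeasurableSet Ω) {u : Plane → ℝ}
    {G : Plane → Plane} (hu : MemLp u 2 (volume.restrict Ω)) :
    ∫⁻ x, sobolevDensity Ω u G x ^ 2 ≤
      2 * ((∫⁻ x in Ω, ‖u x‖ₑ ^ 2) + ∫⁻ x in Ω, ‖G x‖ₑ ^ 2) := by
  rw [← lintegral_add_left' (hu.aestronglyMeasurable.enorm.pow_const 2),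
    ← lintegral_const_mul' _ _ (by simp), ← lintegral_indicator hΩ]
  refine lintegral_mono fun x => ?_
  by_cases hx : x ∈ Ω
  · rw [sobolevDensity, indicator_of_mem hx, indicator_of_mem hx]
    have := ENNReal.rpow_add_le_mul_rpow_add_rpow (‖u x‖ₑ) (‖G x‖ₑ) (one_le_two (α := ℝ))
    norm_num at this
    exact_mod_cast this
  · rw [sobolevDensity, indicator_of_notMem hx]
    simp

lemma lintegral_enorm_sq_ne_top {E : Type*} [NormedAddCommGroup E] {μ : Measure Plane}
    {g : Plane → E} (hg : MemLp g 2 μ) : ∫⁻ x, ‖g x‖ₑ ^ 2 ∂μ ≠ ⊤ := by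
  have := (eLpNorm_lt_top_iff_lintegral_rpow_enorm_lt_top two_ne_zero ENNReal.ofNat_ne_top).1
    hg.eLpNorm_lt_top
  simpa using this.ne

/-- The cone estimate applies to the mollified `u` with density `2 (ρ ⋆ f)`. By associativity its
potential is twice the mollification of the fixed function `f ⋆ₗ rieszKernel R`, so both sides
converge at almost every `x`. How small the mollifier must be may depend on `x`, since the limit is
taken pointwise. -/
theorem exists_ae_enorm_le_riesz {Ω : Set Plane} (hΩ : IsOpen Ω) {R b : ℝ} (hR : 1 ≤ R)
    (hb : 0 < b) (hcone : ConeCondition Ω univ R b) :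
    ∃ C : ℝ, 0 < C ∧ ∀ (u : Plane → ℝ) (G : Plane → Plane), MemLp u 2 (volume.restrict Ω) →
      IsWeakGradient Ω u G → MemLp G 2 (volume.restrict Ω) →
      ∀ᵐ x ∂volume.restrict Ω,
        ‖u x‖ₑ ≤ ENNReal.ofReal C * (sobolevDensity Ω u G ⋆ₗ rieszKernel R) x := by
  have hR0 : 0 < R := by linarith
  set V : ℝ≥0∞ := volume (Metric.closedBall (0 : Plane) b) with hV
  have hV0 : V ≠ 0 := (Metric.measure_closedBall_pos volume _ hb).ne'
  have hVt : V ≠ ⊤ := measure_closedBall_lt_top.ne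
  have hVr : 0 < V.toReal := ENNReal.toReal_pos hV0 hVt
  refine ⟨2 * (R + R ^ 2) / V.toReal, by positivity, fun u G hu hwg hG => ?_⟩
  have hΩm := hΩ.measurableSet
  have hf0 := aemeasurable_sobolevDensity hΩm hu hG
  -- The cone estimate and associativity are applied to a measurable representative; changing the
  -- density on a null set alters none of the convolutions.
  obtain ⟨f, hf, hff⟩ := hf0
  have hsq : ∫⁻ x, f x ^ 2 ≠ ⊤ := by
    have : ∫⁻ x, f x ^ 2 = ∫⁻ x, sobolevDensity Ω u G x ^ 2 :=
      lintegral_congr_ae (by filter_upwards [hff] with x hx; rw [hx])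
    rw [this]
    refine ne_top_of_le_ne_top ?_ (lintegral_sobolevDensity_sq_le hΩm hu)
    exact ENNReal.mul_ne_top (by simp)
      (ENNReal.add_ne_top.2 ⟨lintegral_enorm_sq_ne_top hu, lintegral_enorm_sq_ne_top hG⟩)
  rw [lconvolution_congr_left hff]
  set F : Plane → ℝ≥0∞ := f ⋆ₗ rieszKernel R with hFdef
  have hF : Measurable F := measurable_lconvolution _ hf (measurable_rieszKernel R)
  have hFsq : ∫⁻ x, F x ^ 2 ≠ ⊤ := lintegral_riesz_sq_ne_top hf.aemeasurable hR hsq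
  have hFfin : ∀ᵐ x, F x < ⊤ := by
    filter_upwards [ae_lt_top (hF.pow_const 2) hFsq] with x hx
    exact (ENNReal.pow_lt_top_iff.1 hx).resolve_right two_ne_zero
  have hFi : LocallyIntegrable fun x => (F x).toReal :=
    (memLp_toReal_of_lintegral_sq_ne_top hF hFsq).locallyIntegrable one_le_two
  have hU : LocallyIntegrable (Ω.indicator u) :=
    ((memLp_indicator_iff_restrict hΩm).2 hu).locallyIntegrable one_le_two
  rw [ae_restrict_iff' hΩm]
  filter_upwards [ae_tendsto_mollifierBump hU, ae_tendsto_mollifierBump hFi, hFfin]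
    with x hUx hFx hxfin hxΩ
  obtain ⟨p, r, hbr, hpr, hx⟩ := hcone x ⟨mem_univ x, hxΩ⟩
  rw [indicator_of_mem hxΩ] at hUx
  have hev : ∀ᶠ n in atTop,
      V * ‖((mollifierBump n).normed volume ⋆[lsmul ℝ ℝ, volume] Ω.indicator u) x‖ₑ ≤
        ENNReal.ofReal (R + R ^ 2) * (2 * ENNReal.ofReal
          (((mollifierBump n).normed volume ⋆[lsmul ℝ ℝ, volume] fun x => (F x).toReal) x)) := by
    filter_upwards [eventually_cone_subset hΩ hx] with n hn
    set ρ : Plane → ℝ := (mollifierBump n).normed volume with hρdef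
    have hρ : ContDiff ℝ ∞ ρ := (mollifierBump n).contDiff_normed
    have hρc : HasCompactSupport ρ := (mollifierBump n).hasCompactSupport_normed
    have hρs : tsupport ρ ⊆ Metric.closedBall 0 (mollifierBump n).rOut :=
      (mollifierBump n).tsupport_normed_eq.subset
    have hρ0 : ∀ x, 0 ≤ ρ x := (mollifierBump n).nonneg_normed
    have hρm : Measurable fun z => ‖ρ z‖ₑ := hρ.continuous.measurable.enorm
    rw [ofReal_convolution_toReal hρ.continuous hρc hρ0 hFfin hFi, hFdef,
      lconvolution_assoc hρm hf (measurable_rieszKernel R),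
      ← const_mul_lconvolution 2 (by simp)]
    have hw : ContDiff ℝ 1 (ρ ⋆[lsmul ℝ ℝ, volume] Ω.indicator u) :=
      hρc.contDiff_convolution_left (n := 1) _ (hρ.of_le (by simp)) hU
    refine enorm_le_riesz_of_cone hw
      ((measurable_lconvolution _ hρm hf).const_mul 2) hb hbr hpr fun t ht z hz => ⟨?_, fun v => ?_⟩
    · refine (enorm_convolution_le _ _ _).trans ?_
      rw [← lconvolution_congr_right hff]
      refine (lconvolution_mono_right (fun y => ?_) _).trans (le_mul_of_one_le_left' one_le_two)
      by_cases hy : y ∈ Ω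
      · rw [sobolevDensity, indicator_of_mem hy, indicator_of_mem hy]
        exact le_self_add
      · rw [indicator_of_notMem hy]; simp
    · refine (enorm_fderiv_convolution_le hΩm hU hwg hρ hρc hρs (hn t ht z hz) v).trans ?_
      rw [← lconvolution_congr_right hff]
      gcongr
      refine lconvolution_mono_right (fun y => ?_) _
      by_cases hy : y ∈ Ω
      · rw [sobolevDensity, indicator_of_mem hy, indicator_of_mem hy]
        exact le_add_self
      · rw [indicator_of_notMem hy]; simp
  have hlim : V * ‖u x‖ₑ ≤ ENNReal.ofReal (R + R ^ 2) * (2 * F x) := by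
    rw [← ENNReal.ofReal_toReal hxfin.ne]
    refine le_of_tendsto_of_tendsto
      (ENNReal.Tendsto.const_mul ((continuous_enorm.tendsto _).comp hUx) (Or.inr hVt))
      (ENNReal.Tendsto.const_mul (ENNReal.Tendsto.const_mul
        ((ENNReal.continuous_ofReal.tendsto _).comp hFx) (Or.inr (by simp)))
        (Or.inr ENNReal.ofReal_ne_top)) hev
  rw [ENNReal.ofReal_div_of_pos hVr, ENNReal.ofReal_toReal hVt, mul_comm 2 (R + R ^ 2),
    ENNReal.ofReal_mul (by positivity), ← ENNReal.mul_div_right_comm,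
    ENNReal.le_div_iff_mul_le (Or.inl hV0) (Or.inl hVt)]
  calc ‖u x‖ₑ * V = V * ‖u x‖ₑ := mul_comm _ _
    _ ≤ _ := hlim
    _ = _ := by rw [mul_assoc]; simp

/-! ### Approximation and membership in `E_Φ`. -/

lemma luxemburgNorm_le {A : ℝ → ℝ} {Ω : Set Plane} {u : Plane → ℝ} {l : ℝ} (hl : 0 < l)
    (h : modular A Ω u l ≤ 1) : luxemburgNorm A Ω u ≤ l :=
  csInf_le ⟨0, fun _ hx => hx.1.le⟩ ⟨hl, h⟩

lemma locallyIntegrableOn_of_memLp_two {E : Type*} [NormedAddCommGroup E] {Ω : Set Plane}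
    {u : Plane → E} (hu : MemLp u 2 (volume.restrict Ω)) : LocallyIntegrableOn u Ω :=
  locallyIntegrableOn_of_locallyIntegrable_restrict (hu.locallyIntegrable one_le_two)

/-- Cut off both in value and in space at level `n`; the square integral of the remainder tends to
zero by dominated convergence. -/
lemma exists_split_of_lintegral_sq_ne_top {f : Plane → ℝ≥0∞} (hf : Measurable f)
    (h : ∫⁻ x, f x ^ 2 ≠ ⊤) {η : ℝ≥0∞} (hη : 0 < η) :
    ∃ (n : ℕ) (f₁ f₂ : Plane → ℝ≥0∞), Measurable f₁ ∧ Measurable f₂ ∧ f = f₁ + f₂ ∧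
      (∀ x, f₁ x ≤ n) ∧ (∀ x, (n : ℝ) < ‖x‖ → f₁ x = 0) ∧ ∫⁻ x, f₂ x ^ 2 ≤ η := by
  set S : ℕ → Set Plane := fun n => {x | f x ≤ n} ∩ Metric.closedBall 0 n with hS
  have hSm : ∀ n, MeasurableSet (S n) := fun n =>
    (measurableSet_le hf measurable_const).inter Metric.isClosed_closedBall.measurableSet
  have hfin : ∀ᵐ x, f x < ⊤ := by
    filter_upwards [ae_lt_top (hf.pow_const 2) h] with x hx
    exact (ENNReal.pow_lt_top_iff.1 hx).resolve_right two_ne_zero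
  have hlim : Tendsto (fun n => ∫⁻ x, (S n)ᶜ.indicator f x ^ 2) atTop
      (𝓝 (∫⁻ _ : Plane, 0)) := by
    refine tendsto_lintegral_of_dominated_convergence (fun x => f x ^ 2)
      (fun n => (hf.indicator (hSm n).compl).pow_const 2) (fun n => ae_of_all _ fun x => ?_) h ?_
    · exact pow_le_pow_left' (indicator_le_self _ _ x) 2
    · filter_upwards [hfin] with x hx
      obtain ⟨N, hN⟩ := ENNReal.exists_nat_gt hx.ne
      obtain ⟨N', hN'⟩ := exists_nat_ge ‖x‖
      refine tendsto_const_nhds.congr' ?_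
      filter_upwards [eventually_ge_atTop N, eventually_ge_atTop N'] with n hn hn'
      have hmem : x ∈ S n := by
        refine ⟨hN.le.trans (by exact_mod_cast hn), ?_⟩
        rw [mem_closedBall_zero_iff]
        exact hN'.trans (by exact_mod_cast hn')
      rw [indicator_of_notMem (by simpa using hmem)]
      simp
  rw [lintegral_zero] at hlim
  obtain ⟨n, hn⟩ := (hlim.eventually_lt_const hη).exists
  refine ⟨n, (S n).indicator f, (S n)ᶜ.indicator f, hf.indicator (hSm n),
    hf.indicator (hSm n).compl, (indicator_self_add_compl _ _).symm, fun x => ?_, fun x hx => ?_,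
    hn.le⟩
  · by_cases hx : x ∈ S n
    · rw [indicator_of_mem hx]; exact hx.1
    · rw [indicator_of_notMem hx]; exact zero_le
  · refine indicator_of_notMem (fun hx' => ?_) _
    have := hx'.2
    rw [mem_closedBall_zero_iff] at this
    linarith

lemma lintegral_rieszKernel_ne_top {R : ℝ} (hR : 1 ≤ R) : ∫⁻ y, rieszKernel R y ≠ ⊤ := by
  obtain ⟨C, -, hC⟩ := lintegral_rieszKernel_rpow_le hR
  have := hC 1 le_rfl
  norm_num at this
  exact ne_top_of_le_ne_top ENNReal.ofReal_ne_top this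

lemma riesz_le_of_le_const {f : Plane → ℝ≥0∞} {c : ℝ≥0∞} (hc : ∀ x, f x ≤ c) (R : ℝ)
    (x : Plane) : (f ⋆ₗ rieszKernel R) x ≤ c * ∫⁻ y, rieszKernel R y := by
  rw [lconvolution_rieszKernel_apply,
    ← lintegral_const_mul _ (measurable_rieszKernel R)]
  exact lintegral_mono fun z => mul_le_mul' (hc _) le_rfl

lemma riesz_eq_zero_of_support {f : Plane → ℝ≥0∞} {a R : ℝ} (hf : ∀ x, a < ‖x‖ → f x = 0)
    {x : Plane} (hx : a + R < ‖x‖) : (f ⋆ₗ rieszKernel R) x = 0 := by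
  rw [lconvolution_rieszKernel_apply]
  refine (lintegral_congr fun z => ?_).trans lintegral_zero
  by_cases hz : z ∈ Metric.closedBall (0 : Plane) R
  · rw [mem_closedBall_zero_iff] at hz
    rw [hf (x + z), zero_mul]
    have := norm_sub_le (x + z) z
    rw [add_sub_cancel_right] at this
    linarith
  · rw [rieszKernel, indicator_of_notMem hz, mul_zero]

lemma abs_sub_clamp {B : ℝ} (hB : 0 ≤ B) (t : ℝ) :
    |t - max (-B) (min B t)| = max (|t| - B) 0 := by
  rcases le_total t B with h1 | h1 <;> rcases le_total (-B) t with h2 | h2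
  · rw [min_eq_right h1, max_eq_right h2, sub_self, abs_zero, max_eq_right]
    linarith [abs_le.2 ⟨h2, h1⟩]
  · rw [min_eq_right h1, max_eq_left h2, abs_of_nonpos (by linarith), abs_of_nonpos (by linarith),
      max_eq_left (by linarith)]
    ring
  · rw [min_eq_left h1, max_eq_right (by linarith), abs_of_nonneg (by linarith),
      abs_of_nonneg (by linarith), max_eq_left (by linarith)]
  · rw [min_eq_left h1, max_eq_right (by linarith), abs_of_nonneg (by linarith),
      abs_of_nonneg (by linarith), max_eq_left (by linarith)]

lemma abs_clamp_le {B : ℝ} (hB : 0 ≤ B) (t : ℝ) : |max (-B) (min B t)| ≤ B :=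
  abs_le.2 ⟨le_max_left _ _, max_le (by linarith) (min_le_left _ _)⟩

lemma abs_clamp_le_abs {B : ℝ} (hB : 0 ≤ B) (t : ℝ) : |max (-B) (min B t)| ≤ |t| := by
  refine abs_le.2 ⟨?_, max_le (by linarith [abs_nonneg t]) ((min_le_right _ _).trans (le_abs_self t))⟩
  rw [le_max_iff, le_min_iff]
  right
  exact ⟨by linarith [abs_nonneg t], neg_abs_le t⟩

/-- A function dominated by a Riesz potential of an `L²` function is approximated by bounded
functions with bounded support. -/
lemma exists_bounded_modular_sub_le_one {R : ℝ} (hR : 1 ≤ R) {Ω : Set Plane} {u : Plane → ℝ}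
    (hu : AEStronglyMeasurable u (volume.restrict Ω)) {f : Plane → ℝ≥0∞} (hf : AEMeasurable f)
    (hsq : ∫⁻ x, f x ^ 2 ≠ ⊤)
    (huf : ∀ᵐ x ∂volume.restrict Ω, ‖u x‖ₑ ≤ (f ⋆ₗ rieszKernel R) x) {l : ℝ} (hl : 0 < l) :
    ∃ (v : Plane → ℝ) (B a : ℝ), 0 ≤ B ∧ AEStronglyMeasurable v (volume.restrict Ω) ∧
      (∀ x, |v x| ≤ B) ∧ (∀ x, |v x| ≤ |u x|) ∧ (∀ x, a < ‖x‖ → v x = 0) ∧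
      modular Phi Ω (fun x => u x - v x) l ≤ 1 := by
  obtain ⟨c, hc, hmod⟩ := exists_modular_le_one_of_le_riesz hR
  obtain ⟨g, hg, hfg⟩ := hf
  rw [lconvolution_congr_left hfg] at huf
  have hgsq : ∫⁻ x, g x ^ 2 ≠ ⊤ := by
    rwa [← lintegral_congr_ae (show (fun x => f x ^ 2) =ᵐ[volume] fun x => g x ^ 2 by
      filter_upwards [hfg] with x hx; rw [hx])]
  obtain ⟨n, f₁, f₂, hf₁, hf₂, rfl, hb, hs, hsmall⟩ := exists_split_of_lintegral_sq_ne_top hg hgsq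
    (η := ENNReal.ofReal (c * l ^ 2)) (ENNReal.ofReal_pos.2 (by positivity))
  set B : ℝ := ((n : ℝ≥0∞) * ∫⁻ y, rieszKernel R y).toReal with hB
  have hBtop : (n : ℝ≥0∞) * ∫⁻ y, rieszKernel R y ≠ ⊤ :=
    ENNReal.mul_ne_top (by simp) (lintegral_rieszKernel_ne_top hR)
  have hB0 : 0 ≤ B := ENNReal.toReal_nonneg
  set K : Set Plane := Metric.closedBall 0 (n + R) with hK
  have hKm : MeasurableSet K := Metric.isClosed_closedBall.measurableSet
  -- `B` bounds the potential of `f₁`, so on `K` the excess of `|u|` over `B` is at most the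
  -- potential of `f₂`. Off `K` the potential of `f₁` vanishes, and `u` itself is dominated by that
  -- of `f₂`.
  refine ⟨K.indicator fun x => max (-B) (min B (u x)), B, n + R, hB0, ?_, ?_, ?_, ?_, ?_⟩
  · exact (aestronglyMeasurable_const.sup (aestronglyMeasurable_const.inf hu)).indicator hKm
  · intro x
    by_cases hx : x ∈ K
    · rw [indicator_of_mem hx]; exact abs_clamp_le hB0 _
    · rw [indicator_of_notMem hx]; simpa using hB0
  · intro x
    by_cases hx : x ∈ K
    · rw [indicator_of_mem hx]; exact abs_clamp_le_abs hB0 _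
    · rw [indicator_of_notMem hx]; simp
  · intro x hx
    exact indicator_of_notMem (by rw [hK, mem_closedBall_zero_iff]; linarith) _
  · refine hmod f₂ _ Ω l hf₂.aemeasurable hl ?_ hsmall
    filter_upwards [huf] with x hx
    have hadd : ((f₁ + f₂) ⋆ₗ rieszKernel R) x =
        (f₁ ⋆ₗ rieszKernel R) x + (f₂ ⋆ₗ rieszKernel R) x := by
      simp only [lconvolution_def, Pi.add_apply, add_mul]
      exact lintegral_add_left (hf₁.mul ((measurable_rieszKernel R).comp (by fun_prop))) _
    rw [hadd] at hx
    by_cases hxK : x ∈ K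
    · rw [indicator_of_mem hxK, Real.enorm_eq_ofReal_abs, abs_sub_clamp hB0]
      have h1 : (f₁ ⋆ₗ rieszKernel R) x ≤ ENNReal.ofReal B := by
        rw [hB, ENNReal.ofReal_toReal hBtop]
        exact riesz_le_of_le_const hb R x
      rw [ENNReal.ofReal_max, ENNReal.ofReal_zero, ENNReal.ofReal_sub _ hB0]
      refine max_le ?_ zero_le
      rw [tsub_le_iff_left, ← Real.enorm_eq_ofReal_abs]
      exact hx.trans (add_le_add h1 le_rfl)
    · rw [indicator_of_notMem hxK, sub_zero]
      rw [hK, mem_closedBall_zero_iff, not_le] at hxK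
      rwa [riesz_eq_zero_of_support hs hxK, zero_add] at hx

lemma Phi_nonneg (t : ℝ) : 0 ≤ Phi t := by
  unfold Phi
  linarith [Real.one_le_exp (sq_nonneg t)]

lemma Phi_le_Phi {s t : ℝ} (hs : 0 ≤ s) (hst : s ≤ t) : Phi s ≤ Phi t := by
  unfold Phi
  gcongr

lemma continuous_Phi : Continuous Phi := by
  unfold Phi
  fun_prop

/-- Midpoint convexity: `((s+t)/2)² ≤ s²/2 + t²/2`, followed by the arithmetic-geometric mean
inequality for the exponentials. -/
lemma Phi_half_add_le (s t : ℝ) : Phi ((s + t) / 2) ≤ (Phi s + Phi t) / 2 := by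
  unfold Phi
  have h1 : Real.exp (((s + t) / 2) ^ 2) ≤ Real.exp (s ^ 2 / 2) * Real.exp (t ^ 2 / 2) := by
    rw [← Real.exp_add]
    apply Real.exp_le_exp.2
    nlinarith [sq_nonneg (s - t)]
  have h2 : Real.exp (s ^ 2) = Real.exp (s ^ 2 / 2) ^ 2 := by
    rw [← Real.exp_nat_mul]; congr 1; push_cast; ring
  have h3 : Real.exp (t ^ 2) = Real.exp (t ^ 2 / 2) ^ 2 := by
    rw [← Real.exp_nat_mul]; congr 1; push_cast; ring
  nlinarith [sq_nonneg (Real.exp (s ^ 2 / 2) - Real.exp (t ^ 2 / 2))]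

/-- Midpoint convexity of `Phi` stands in for the triangle inequality of the Luxemburg norm, in the
case of equal levels. -/
lemma modular_Phi_add_le_one {Ω : Set Plane} {u v : Plane → ℝ} {l : ℝ} (hl : 0 < l)
    (hum : AEStronglyMeasurable u (volume.restrict Ω))
    (hu : modular Phi Ω u l ≤ 1) (hv : modular Phi Ω v l ≤ 1) :
    modular Phi Ω (fun x => u x + v x) (2 * l) ≤ 1 := by
  have hpt : ∀ x, ENNReal.ofReal (Phi (|u x + v x| / (2 * l))) ≤
      2⁻¹ * (ENNReal.ofReal (Phi (|u x| / l)) + ENNReal.ofReal (Phi (|v x| / l))) := by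
    intro x
    have h1 : Phi (|u x + v x| / (2 * l)) ≤ (Phi (|u x| / l) + Phi (|v x| / l)) / 2 := by
      refine (Phi_le_Phi (by positivity) ?_).trans (Phi_half_add_le _ _)
      rw [← add_div, div_div, mul_comm l]
      gcongr
      exact abs_add_le _ _
    refine (ENNReal.ofReal_le_ofReal h1).trans_eq ?_
    rw [ENNReal.ofReal_div_of_pos two_pos, ENNReal.ofReal_add (Phi_nonneg _) (Phi_nonneg _),
      ENNReal.div_eq_inv_mul, ENNReal.ofReal_ofNat]
  have hm : AEMeasurable (fun x => ENNReal.ofReal (Phi (|u x| / l))) (volume.restrict Ω) :=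
    (ENNReal.measurable_ofReal.comp continuous_Phi.measurable).comp_aemeasurable
      ((continuous_abs.measurable.comp_aemeasurable hum.aemeasurable).div_const l)
  calc modular Phi Ω (fun x => u x + v x) (2 * l)
      ≤ ∫⁻ x in Ω, 2⁻¹ * (ENNReal.ofReal (Phi (|u x| / l)) + ENNReal.ofReal (Phi (|v x| / l))) :=
        lintegral_mono hpt
    _ = 2⁻¹ * (modular Phi Ω u l + modular Phi Ω v l) := by
        rw [lintegral_const_mul' _ _ (by simp), lintegral_add_left' hm]
        rfl
    _ ≤ 2⁻¹ * (1 + 1) := by gcongr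
    _ = 1 := by rw [one_add_one_eq_two, ENNReal.inv_mul_cancel (by simp) (by simp)]

/-- Mollify. The mollified functions keep the bound `B` and vanish outside the ball of radius `a +
1`, so `Phi (2 * B / l)` on that ball dominates the modulars, which tend to zero. -/
lemma exists_testFunction_modular_sub_le_one {v : Plane → ℝ} (hv : AEStronglyMeasurable v)
    {B a : ℝ} (hB0 : 0 ≤ B) (hB : ∀ x, |v x| ≤ B) (ha : ∀ x, a < ‖x‖ → v x = 0) {l : ℝ}
    (hl : 0 < l) :
    ∃ φ : Plane → ℝ, IsTestFunction univ φ ∧ modular Phi univ (fun x => v x - φ x) l ≤ 1 := by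
  have hvs : Function.support v ⊆ Metric.closedBall 0 a := fun x hx => by
    rw [mem_closedBall_zero_iff]
    by_contra h
    exact hx (ha x (not_le.1 h))
  have hvc : HasCompactSupport v :=
    HasCompactSupport.of_support_subset_isCompact (isCompact_closedBall 0 a) hvs
  have hvi : LocallyIntegrable v := by
    refine (locallyIntegrable_const B).mono hv (ae_of_all _ fun x => ?_)
    simpa [abs_of_nonneg hB0] using hB x
  set w : ℕ → Plane → ℝ := fun n => (mollifierBump n).normed volume ⋆[lsmul ℝ ℝ, volume] v with hw
  have hwt : ∀ n, IsTestFunction univ (w n) := fun n =>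
    ⟨(mollifierBump n).hasCompactSupport_normed.contDiff_convolution_left _
      (mollifierBump n).contDiff_normed hvi,
      (mollifierBump n).hasCompactSupport_normed.convolution _ hvc, subset_univ _⟩
  have hwB : ∀ n x, |w n x| ≤ B := by
    intro n x
    have hint := (mollifierBump n).integrable_normed (μ := volume)
    calc |w n x| = ‖∫ t, (mollifierBump n).normed volume t * v (x - t)‖ := rfl
      _ ≤ ∫ t, (mollifierBump n).normed volume t * B := by
          refine norm_integral_le_of_norm_le (hint.mul_const B) (ae_of_all _ fun t => ?_)
          rw [norm_mul, Real.norm_of_nonneg ((mollifierBump n).nonneg_normed t)]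
          exact mul_le_mul_of_nonneg_left (hB _) ((mollifierBump n).nonneg_normed t)
      _ = B := by rw [integral_mul_const, (mollifierBump n).integral_normed, one_mul]
  have hw0 : ∀ n x, a + 1 < ‖x‖ → w n x = 0 := by
    intro n x hx
    by_contra h
    obtain ⟨y, hy, z, hz, rfl⟩ := support_convolution_subset (μ := (volume : Measure Plane))
      (f := (mollifierBump n).normed volume) (g := v) (lsmul ℝ ℝ : ℝ →L[ℝ] ℝ →L[ℝ] ℝ) h
    rw [(mollifierBump n).support_normed_eq, mem_ball_zero_iff] at hy
    have h1 := hvs hz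
    rw [mem_closedBall_zero_iff] at h1
    have h2 : (mollifierBump n).rOut ≤ 1 := by
      show (1 : ℝ) / (n + 1) ≤ 1
      rw [div_le_one (by positivity)]
      linarith [(Nat.cast_nonneg n : (0 : ℝ) ≤ n)]
    linarith [norm_add_le y z]
  have hlim : Tendsto (fun n => ∫⁻ x, ENNReal.ofReal (Phi (|v x - w n x| / l))) atTop
      (𝓝 (∫⁻ _ : Plane, 0)) := by
    refine tendsto_lintegral_of_dominated_convergence'
      ((Metric.closedBall (0 : Plane) (a + 1)).indicator
        fun _ => ENNReal.ofReal (Phi (2 * B / l))) (fun n => ?_)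
      (fun n => ae_of_all _ fun x => ?_) ?_ ?_
    · exact (ENNReal.measurable_ofReal.comp continuous_Phi.measurable).comp_aemeasurable
        ((continuous_abs.measurable.comp_aemeasurable
          (hv.aemeasurable.sub (hwt n).1.continuous.aemeasurable)).div_const l)
    · by_cases hx : x ∈ Metric.closedBall (0 : Plane) (a + 1)
      · rw [indicator_of_mem hx]
        apply ENNReal.ofReal_le_ofReal
        refine Phi_le_Phi (by positivity) ?_
        gcongr
        linarith [abs_sub (v x) (w n x), hB x, hwB n x]
      · rw [mem_closedBall_zero_iff, not_le] at hx
        show ENNReal.ofReal (Phi (|v x - w n x| / l)) ≤ _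
        rw [hw0 n x hx, ha x (by linarith)]
        simp [Phi]
    · rw [lintegral_indicator Metric.isClosed_closedBall.measurableSet, setLIntegral_const]
      exact ENNReal.mul_ne_top ENNReal.ofReal_ne_top measure_closedBall_lt_top.ne
    · filter_upwards [ae_tendsto_mollifierBump hvi] with x hx
      have h1 : Continuous fun s : ℝ => ENNReal.ofReal (Phi (|v x - s| / l)) :=
        ENNReal.continuous_ofReal.comp (continuous_Phi.comp (by fun_prop))
      have h2 : Tendsto (fun n => ENNReal.ofReal (Phi (|v x - w n x| / l))) atTop
          (𝓝 (ENNReal.ofReal (Phi (|v x - v x| / l)))) := (h1.tendsto (v x)).comp hx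
      rwa [show ENNReal.ofReal (Phi (|v x - v x| / l)) = 0 by simp [Phi]] at h2
  rw [lintegral_zero] at hlim
  obtain ⟨n, hn⟩ := (hlim.eventually_lt_const one_pos).exists
  refine ⟨w n, hwt n, ?_⟩
  unfold modular
  rw [Measure.restrict_univ]
  exact hn.le

lemma memE_of_le_riesz {Ω : Set Plane} (hΩ : IsSmoothBoundedDomain Ω ∨ Ω = univ) {R : ℝ}
    (hR : 1 ≤ R) {u : Plane → ℝ} (hu : MemLp u 2 (volume.restrict Ω)) {f : Plane → ℝ≥0∞}
    (hf : AEMeasurable f) (hsq : ∫⁻ x, f x ^ 2 ≠ ⊤)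
    (huf : ∀ᵐ x ∂volume.restrict Ω, ‖u x‖ₑ ≤ (f ⋆ₗ rieszKernel R) x) : MemE Phi Ω u := by
  refine ⟨⟨locallyIntegrableOn_of_memLp_two hu, ?_⟩, fun ε hε => ?_⟩
  · obtain ⟨c, hc, hmod⟩ := exists_modular_le_one_of_le_riesz hR
    -- Adding `1` forces `l ≤ l²`, so a level linear in `∫ f²` already satisfies `∫ f² ≤ c l²`.
    set l : ℝ := (∫⁻ x, f x ^ 2).toReal / c + 1 with hl
    have hl0 : 0 ≤ (∫⁻ x, f x ^ 2).toReal / c := by positivity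
    have hl1 : 1 ≤ l := by linarith
    refine ⟨l, by linarith, (hmod f u Ω l hf (by linarith) huf ?_).trans_lt ENNReal.one_lt_top⟩
    rw [← ENNReal.ofReal_toReal hsq]
    apply ENNReal.ofReal_le_ofReal
    calc (∫⁻ x, f x ^ 2).toReal = c * ((∫⁻ x, f x ^ 2).toReal / c) := by field_simp
      _ ≤ c * l := by rw [hl]; gcongr; linarith
      _ ≤ c * l ^ 2 := by gcongr; nlinarith
  -- On the plane the truncation error and the mollification error, each at level `ε / 4`, combine
  -- at level `ε / 2`, which leaves room for the strict inequality. On a bounded domain `v` itself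
  -- is the approximant.
  obtain ⟨v, B, a, hB0, hvm, hvB, hvu, hva, hmod⟩ :=
    exists_bounded_modular_sub_le_one hR hu.aestronglyMeasurable hf hsq huf
      (l := ε / 4) (by positivity)
  have hv2 : MemLp v 2 (volume.restrict Ω) := hu.mono hvm (ae_of_all _ hvu)
  rcases hΩ with hΩ | rfl
  · have hfin : volume Ω < ⊤ := hΩ.isBounded.measure_lt_top
    refine ⟨v, fun _ => memLp_top_of_bound hvm B (ae_of_all _ hvB), fun h => absurd h hfin.ne,
      ⟨locallyIntegrableOn_of_memLp_two (hu.sub hv2), ε / 4, by positivity,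
        hmod.trans_lt ENNReal.one_lt_top⟩, ?_⟩
    exact (luxemburgNorm_le (by positivity) hmod).trans_lt (by linarith)
  · rw [Measure.restrict_univ] at hvm
    obtain ⟨φ, hφ, hmodφ⟩ := exists_testFunction_modular_sub_le_one hvm hB0 hvB hva
      (l := ε / 4) (by positivity)
    have hsum : modular Phi univ (fun x => u x - φ x) (2 * (ε / 4)) ≤ 1 := by
      have := modular_Phi_add_le_one (by positivity)
        (hu.sub hv2).aestronglyMeasurable hmod hmodφ
      simpa using this
    have hφ2 : MemLp φ 2 (volume.restrict univ) := by
      rw [Measure.restrict_univ]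
      exact hφ.1.continuous.memLp_of_hasCompactSupport hφ.2.1
    refine ⟨φ, fun h => absurd h (by simp), fun _ => hφ,
      ⟨locallyIntegrableOn_of_memLp_two (hu.sub hφ2), 2 * (ε / 4), by positivity,
        hsum.trans_lt ENNReal.one_lt_top⟩, ?_⟩
    exact (luxemburgNorm_le (by positivity) hsum).trans_lt (by linarith)

end OrliczPlane

namespace OrliczPlane

open scoped ENNReal NNReal Topology
open Filter

/-! ### Uniqueness of weak gradients and the embedding of `H¹`. -/

lemma IsTestFunction.integrable_mul {Ω : Set Plane} {φ : Plane → ℝ} (hφ : IsTestFunction Ω φ)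
    {g : Plane → ℝ} (hg : LocallyIntegrableOn g Ω) : Integrable fun x => g x * φ x := by
  have h1 : IntegrableOn (fun x => g x * φ x) (tsupport φ) :=
    (hg.integrableOn_compact_subset hφ.2.2 hφ.2.1).mul_continuousOn
      hφ.1.continuous.continuousOn hφ.2.1
  refine (integrableOn_iff_integrable_of_support_subset fun x hx => ?_).1 h1
  exact subset_tsupport φ (right_ne_zero_of_mul hx)

lemma locallyIntegrableOn_apply {Ω : Set Plane} {G : Plane → Plane}
    (hG : LocallyIntegrableOn G Ω) (i : Fin 2) : LocallyIntegrableOn (fun x => G x i) Ω := by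
  intro x hx
  obtain ⟨s, hs, h⟩ := hG x hx
  exact ⟨s, hs, (EuclideanSpace.proj (𝕜 := ℝ) i).integrable_comp h⟩

/-- The fundamental lemma of the calculus of variations, one component at a time. Because
`weakGradient` is an arbitrary choice, square integrability of one weak gradient reaches it only
through this uniqueness. -/
lemma IsWeakGradient.ae_eq {Ω : Set Plane} (hΩ : IsOpen Ω) {u : Plane → ℝ} {G G' : Plane → Plane}
    (hG : IsWeakGradient Ω u G) (hG' : IsWeakGradient Ω u G') :
    G =ᵐ[volume.restrict Ω] G' := by
  have hi : ∀ i : Fin 2, ∀ᵐ x, x ∈ Ω → G x i - G' x i = 0 := by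
    intro i
    have h1 := locallyIntegrableOn_apply hG.2.1 i
    have h2 := locallyIntegrableOn_apply hG'.2.1 i
    refine hΩ.ae_eq_zero_of_integral_contDiff_smul_eq_zero (h1.sub h2) fun φ hφ hφc hφs => ?_
    have ht : IsTestFunction Ω φ := ⟨hφ, hφc, hφs⟩
    have hset : ∫ x in Ω, φ x • (G x i - G' x i) = ∫ x, φ x • (G x i - G' x i) := by
      refine setIntegral_eq_integral_of_forall_compl_eq_zero fun x hx => ?_
      rw [image_eq_zero_of_notMem_tsupport fun h => hx (hφs h), zero_smul]
    have heq := (hG.2.2 φ ht i).symm.trans (hG'.2.2 φ ht i)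
    rw [neg_inj] at heq
    show ∫ x, φ x • (G x i - G' x i) = 0
    rw [← hset]
    calc ∫ x in Ω, φ x • (G x i - G' x i)
        = ∫ x in Ω, (G x i * φ x - G' x i * φ x) := by
          congr 1; ext x; rw [smul_eq_mul]; ring
      _ = 0 := by
          rw [integral_sub (ht.integrable_mul h1).integrableOn (ht.integrable_mul h2).integrableOn,
            heq, sub_self]
  rw [EventuallyEq, ae_restrict_iff' hΩ.measurableSet]
  filter_upwards [hi 0, hi 1] with x h0 h1 hx
  ext i
  fin_cases i
  · exact sub_eq_zero.1 (h0 hx)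
  · exact sub_eq_zero.1 (h1 hx)

lemma IsWeakGradient.weakGradient {Ω : Set Plane} {u : Plane → ℝ} {G : Plane → Plane}
    (hG : IsWeakGradient Ω u G) : IsWeakGradient Ω u (weakGradient Ω u) := by
  have h : ∃ G, IsWeakGradient Ω u G := ⟨G, hG⟩
  unfold OrliczPlane.weakGradient
  rw [dif_pos h]
  exact h.choose_spec

lemma MemH1.isWeakGradient {Ω : Set Plane} {u : Plane → ℝ} (hu : MemH1 Ω u) :
    IsWeakGradient Ω u (weakGradient Ω u) := by
  obtain ⟨-, G, hG, -⟩ := hu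
  exact hG.weakGradient

lemma MemH1.memLp_weakGradient {Ω : Set Plane} (hΩ : IsOpen Ω) {u : Plane → ℝ}
    (hu : MemH1 Ω u) : MemLp (weakGradient Ω u) 2 (volume.restrict Ω) := by
  obtain ⟨-, G, hG, hG2⟩ := hu
  exact (memLp_congr_ae (hG.ae_eq hΩ hG.weakGradient)).1 hG2

lemma lintegral_enorm_sq_eq {E : Type*} [NormedAddCommGroup E] {μ : Measure Plane}
    {g : Plane → E} (hg : MemLp g 2 μ) :
    ∫⁻ x, ‖g x‖ₑ ^ 2 ∂μ = ENNReal.ofReal (∫ x, ‖g x‖ ^ 2 ∂μ) := by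
  rw [ofReal_integral_eq_lintegral_ofReal (hg.integrable_norm_pow two_ne_zero) (ae_of_all _ fun x => by positivity)]
  refine lintegral_congr fun x => ?_
  rw [ENNReal.ofReal_pow (norm_nonneg _), ofReal_norm]

lemma h1Norm_sq {Ω : Set Plane} (u : Plane → ℝ) :
    h1Norm Ω u ^ 2 = (∫ x in Ω, ‖weakGradient Ω u x‖ ^ 2) + ∫ x in Ω, u x ^ 2 :=
  Real.sq_sqrt (add_nonneg (integral_nonneg fun _ => by positivity)
    (integral_nonneg fun _ => by positivity))

lemma lintegral_sobolevDensity_sq_le_h1Norm {Ω : Set Plane} (hΩ : IsOpen Ω) {u : Plane → ℝ}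
    (hu : MemH1 Ω u) :
    ∫⁻ x, sobolevDensity Ω u (weakGradient Ω u) x ^ 2 ≤ ENNReal.ofReal (2 * h1Norm Ω u ^ 2) := by
  refine (lintegral_sobolevDensity_sq_le hΩ.measurableSet hu.1).trans_eq ?_
  rw [lintegral_enorm_sq_eq hu.1, lintegral_enorm_sq_eq (hu.memLp_weakGradient hΩ),
    ← ENNReal.ofReal_add (integral_nonneg fun _ => by positivity)
      (integral_nonneg fun _ => by positivity), h1Norm_sq, ENNReal.ofReal_mul zero_le_two,
    ENNReal.ofReal_ofNat, add_comm]
  simp only [Real.norm_eq_abs, sq_abs]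

lemma isOpen_of_isSmoothBoundedDomain_or_univ {Ω : Set Plane}
    (hΩ : IsSmoothBoundedDomain Ω ∨ Ω = univ) : IsOpen Ω := by
  rcases hΩ with h | rfl
  · exact h.isOpen
  · exact isOpen_univ

/-- Trudinger's embedding of `H¹(Ω)`. -/
theorem exists_luxemburgNorm_le_h1Norm {Ω : Set Plane}
    (hΩ : IsSmoothBoundedDomain Ω ∨ Ω = univ) :
    ∃ C : ℝ, 0 < C ∧ ∀ u : Plane → ℝ, MemH1 Ω u →
      MemE Phi Ω u ∧ luxemburgNorm Phi Ω u ≤ C * h1Norm Ω u := by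
  have hΩo := isOpen_of_isSmoothBoundedDomain_or_univ hΩ
  obtain ⟨R, b, hR, hb, hcone⟩ := exists_coneCondition hΩ
  obtain ⟨C, hC, hriesz⟩ := exists_ae_enorm_le_riesz hΩo hR hb hcone
  obtain ⟨c, hc, hmod⟩ := exists_modular_le_one_of_le_riesz hR
  -- The density satisfies `∫ f² ≤ 2 C² ‖u‖²` in the `H¹` norm, and the exponential bound asks for
  -- `∫ f² ≤ c l²`.
  refine ⟨Real.sqrt (2 * C ^ 2 / c), by positivity, fun u hu => ?_⟩
  have hG2 := hu.memLp_weakGradient hΩo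
  have hbound := hriesz u _ hu.1 hu.isWeakGradient hG2
  have hfm := aemeasurable_sobolevDensity hΩo.measurableSet hu.1 hG2
  set f : Plane → ℝ≥0∞ := fun y => ENNReal.ofReal C * sobolevDensity Ω u (weakGradient Ω u) y
  have hf : AEMeasurable f := hfm.const_mul _
  have huf : ∀ᵐ x ∂volume.restrict Ω, ‖u x‖ₑ ≤ (f ⋆ₗ rieszKernel R) x := by
    filter_upwards [hbound] with x hx
    rwa [const_mul_lconvolution _ ENNReal.ofReal_ne_top]
  have hfsq : ∫⁻ x, f x ^ 2 ≤ ENNReal.ofReal (2 * C ^ 2 * h1Norm Ω u ^ 2) := by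
    simp only [f, mul_pow]
    rw [lintegral_const_mul'' _ (hfm.pow_const 2)]
    refine (mul_le_mul' le_rfl (lintegral_sobolevDensity_sq_le_h1Norm hΩo hu)).trans_eq ?_
    rw [← ENNReal.ofReal_pow hC.le, ← ENNReal.ofReal_mul (by positivity)]
    congr 1; ring
  refine ⟨memE_of_le_riesz hΩ hR hu.1 hf (ne_top_of_le_ne_top ENNReal.ofReal_ne_top hfsq) huf, ?_⟩
  -- Levels strictly above the bound are used because the `H¹` norm may vanish, while an admissible
  -- `l` must be positive.
  refine le_of_forall_gt_imp_ge_of_dense fun l hl => ?_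
  have hn : 0 ≤ h1Norm Ω u := Real.sqrt_nonneg _
  have hl0 : 0 < l := lt_of_le_of_lt (by positivity) hl
  refine luxemburgNorm_le hl0 (hmod f u Ω l hf hl0 huf (hfsq.trans (ENNReal.ofReal_le_ofReal ?_)))
  have h1 : (Real.sqrt (2 * C ^ 2 / c) * h1Norm Ω u) ^ 2 ≤ l ^ 2 := by gcongr
  rw [mul_pow, Real.sq_sqrt (by positivity)] at h1
  calc 2 * C ^ 2 * h1Norm Ω u ^ 2 = c * (2 * C ^ 2 / c * h1Norm Ω u ^ 2) := by field_simp
    _ ≤ c * l ^ 2 := by gcongr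

/-! ### Poincaré's inequality on `H¹₀`. -/

/-- The classical gradient, as a vector field. -/
noncomputable def classicalGradient (φ : Plane → ℝ) (x : Plane) : Plane :=
  WithLp.toLp 2 fun i => fderiv ℝ φ x (EuclideanSpace.single i 1)

lemma IsTestFunction.continuous_fderiv_apply {Ω : Set Plane} {φ : Plane → ℝ}
    (hφ : IsTestFunction Ω φ) (v : Plane) : Continuous fun x => fderiv ℝ φ x v :=
  (hφ.1.continuous_fderiv (by simp)).clm_apply continuous_const

lemma IsTestFunction.memLp_classicalGradient {Ω : Set Plane} {φ : Plane → ℝ}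
    (hφ : IsTestFunction Ω φ) : MemLp (classicalGradient φ) 2 := by
  have hc : Continuous (classicalGradient φ) :=
    (PiLp.continuous_toLp 2 _).comp (continuous_pi fun i => hφ.continuous_fderiv_apply _)
  refine hc.memLp_of_hasCompactSupport ((hφ.2.1.fderiv ℝ).mono fun x hx h => hx ?_)
  ext i
  simp [classicalGradient, h]

lemma IsTestFunction.memLp {Ω : Set Plane} {φ : Plane → ℝ}
    (hφ : IsTestFunction Ω φ) : MemLp φ 2 :=
  hφ.1.continuous.memLp_of_hasCompactSupport hφ.2.1

lemma IsTestFunction.isWeakGradient {Ω : Set Plane} {φ : Plane → ℝ}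
    (hφ : IsTestFunction Ω φ) : IsWeakGradient Ω φ (classicalGradient φ) := by
  refine ⟨(hφ.memLp.locallyIntegrable one_le_two).locallyIntegrableOn _,
    (hφ.memLp_classicalGradient.locallyIntegrable one_le_two).locallyIntegrableOn _,
    fun ψ hψ i => ?_⟩
  have hcφ := hφ.1.continuous
  have hcψ := hψ.1.continuous
  have hdφ := hφ.continuous_fderiv_apply (EuclideanSpace.single i 1)
  have hdψ := hψ.continuous_fderiv_apply (EuclideanSpace.single i 1)
  rw [setIntegral_eq_integral_of_forall_compl_eq_zero fun x hx => by
      rw [image_eq_zero_of_notMem_tsupport fun h => hx (hφ.2.2 h), zero_mul],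
    setIntegral_eq_integral_of_forall_compl_eq_zero fun x hx => by
      rw [image_eq_zero_of_notMem_tsupport fun h => hx (hψ.2.2 h), mul_zero]]
  refine integral_mul_fderiv_eq_neg_fderiv_mul_of_integrable ?_ ?_ ?_
    (fun x _ => hφ.1.differentiable (by simp) x) (fun x _ => hψ.1.differentiable (by simp) x)
  · exact (hdφ.mul hcψ).integrable_of_hasCompactSupport hψ.2.1.mul_left
  · exact (hcφ.mul hdψ).integrable_of_hasCompactSupport hφ.2.1.mul_right
  · exact (hcφ.mul hcψ).integrable_of_hasCompactSupport hφ.2.1.mul_right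

lemma IsWeakGradient.sub {Ω : Set Plane} {u v : Plane → ℝ} {G H : Plane → Plane}
    (hu : IsWeakGradient Ω u G) (hv : IsWeakGradient Ω v H) :
    IsWeakGradient Ω (fun x => u x - v x) (fun x => G x - H x) := by
  refine ⟨hu.1.sub hv.1, hu.2.1.sub hv.2.1, fun φ hφ i => ?_⟩
  -- A partial derivative of a test function is again one, which makes the products `u ∂φ`
  -- integrable, so that the integrals may be split.
  have hdφ : IsTestFunction Ω fun x => fderiv ℝ φ x (EuclideanSpace.single i 1) :=
    ⟨(hφ.1.fderiv_right (m := ∞) (by simp)).clm_apply contDiff_const,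
      hφ.2.1.fderiv_apply ℝ _, (tsupport_fderiv_apply_subset ℝ _).trans hφ.2.2⟩
  simp only [sub_mul, PiLp.sub_apply]
  rw [integral_sub (hdφ.integrable_mul hu.1).integrableOn (hdφ.integrable_mul hv.1).integrableOn,
    integral_sub (hφ.integrable_mul (locallyIntegrableOn_apply hu.2.1 i)).integrableOn
      (hφ.integrable_mul (locallyIntegrableOn_apply hv.2.1 i)).integrableOn,
    hu.2.2 φ hφ i, hv.2.2 φ hφ i]
  ring

/-- Poincaré's inequality for test functions. -/
lemma IsTestFunction.integral_sq_le {Ω : Set Plane} {D : ℝ} (hD : 0 ≤ D)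
    (hΩ : Ω ⊆ Metric.closedBall 0 D) {φ : Plane → ℝ} (hφ : IsTestFunction Ω φ) :
    ∫ x, ‖φ x‖ ^ 2 ≤ (2 * D) ^ 2 * ∫ x, ‖classicalGradient φ x‖ ^ 2 := by
  set e : Plane := EuclideanSpace.single 0 1 with he
  have hcφ := hφ.1.continuous
  have hdφ := hφ.continuous_fderiv_apply e
  have hsupp := hφ.2.1
  have hderiv : ∀ x, fderiv ℝ (fun x => φ x ^ 2) x e = 2 * φ x * fderiv ℝ φ x e := by
    intro x
    have h := ((hφ.1.differentiable (by simp) x).hasFDerivAt.pow 2).fderiv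
    rw [h]
    simp
  have hsq : HasCompactSupport fun x => φ x ^ 2 :=
    hsupp.mono fun x hx h => hx (by simp [h])
  have hprod : HasCompactSupport fun x : Plane => x 0 * (2 * φ x * fderiv ℝ φ x e) :=
    hsupp.mono fun x hx h => hx (by simp [h])
  have hcoord : ∀ x, fderiv ℝ (fun x : Plane => x 0) x e = 1 := by
    intro x
    have h := (EuclideanSpace.proj (𝕜 := ℝ) (0 : Fin 2)).hasFDerivAt (x := x)
    have h' : fderiv ℝ (fun x : Plane => x 0) x = EuclideanSpace.proj (𝕜 := ℝ) (0 : Fin 2) := h.fderiv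
    rw [h']
    simp [he]
  have hc0 : Continuous fun x : Plane => x 0 := by fun_prop
  -- The coordinate `x 0` has derivative `1` along `e` and is bounded by `D` on `Ω`: integrating by
  -- parts against it turns `∫ φ²` into `-∫ x₀ · 2φ ∂₀φ`.
  have hibp : ∫ x : Plane, x 0 * fderiv ℝ (fun x => φ x ^ 2) x e =
      -∫ x : Plane, fderiv ℝ (fun x : Plane => x 0) x e * φ x ^ 2 := by
    refine integral_mul_fderiv_eq_neg_fderiv_mul_of_integrable ?_ ?_ ?_
      (fun x _ => by fun_prop) (fun x _ => (hφ.1.differentiable (by simp) x).pow 2)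
    · simp only [hcoord, one_mul]
      exact (hcφ.pow 2).integrable_of_hasCompactSupport hsq
    · simp only [hderiv]
      exact (hc0.mul ((continuous_const.mul hcφ).mul hdφ)).integrable_of_hasCompactSupport hprod
    · exact (hc0.mul (hcφ.pow 2)).integrable_of_hasCompactSupport hsq.mul_left
  simp only [hcoord, hderiv, one_mul] at hibp
  have hI1 : Integrable fun x => ‖φ x‖ ^ 2 := hφ.memLp.integrable_norm_pow two_ne_zero
  have hI2 : Integrable fun x => ‖classicalGradient φ x‖ ^ 2 :=
    hφ.memLp_classicalGradient.integrable_norm_pow two_ne_zero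
  -- The weights are chosen so that half of `∫ φ²` can be absorbed on the left, which yields the
  -- constant `4 D² = (2D)²`.
  have hpt : ∀ x, -(x 0 * (2 * φ x * fderiv ℝ φ x e)) ≤
      1 / 2 * ‖φ x‖ ^ 2 + 2 * D ^ 2 * ‖classicalGradient φ x‖ ^ 2 := by
    intro x
    have hg : |fderiv ℝ φ x e| ≤ ‖classicalGradient φ x‖ :=
      abs_apply_le_norm (classicalGradient φ x) 0
    by_cases hx : x ∈ Ω
    · have hx0 : |x 0| ≤ D := (abs_apply_le_norm x 0).trans (by simpa using hΩ hx)
      calc -(x 0 * (2 * φ x * fderiv ℝ φ x e)) ≤ |x 0 * (2 * φ x * fderiv ℝ φ x e)| :=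
            neg_le_abs _
        _ = |x 0| * (2 * |φ x| * |fderiv ℝ φ x e|) := by
            rw [abs_mul, abs_mul, abs_mul, abs_two]
        _ ≤ D * (2 * |φ x| * ‖classicalGradient φ x‖) := by gcongr
        _ ≤ _ := by
            rw [Real.norm_eq_abs]
            nlinarith [sq_nonneg (|φ x| - 2 * D * ‖classicalGradient φ x‖)]
    · rw [image_eq_zero_of_notMem_tsupport fun h => hx (hφ.2.2 h)]
      simp
      positivity
  have hle : ∫ x, ‖φ x‖ ^ 2 ≤
      1 / 2 * (∫ x, ‖φ x‖ ^ 2) + 2 * D ^ 2 * ∫ x, ‖classicalGradient φ x‖ ^ 2 := by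
    calc ∫ x, ‖φ x‖ ^ 2 = ∫ x, φ x ^ 2 := by simp only [Real.norm_eq_abs, sq_abs]
      _ = ∫ x : Plane, -(x 0 * (2 * φ x * fderiv ℝ φ x e)) := by
          rw [integral_neg, hibp, neg_neg]
      _ ≤ ∫ x, (1 / 2 * ‖φ x‖ ^ 2 + 2 * D ^ 2 * ‖classicalGradient φ x‖ ^ 2) := by
          refine integral_mono ?_ ((hI1.const_mul _).add (hI2.const_mul _)) hpt
          exact ((hc0.mul ((continuous_const.mul hcφ).mul hdφ)).integrable_of_hasCompactSupport hprod).neg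
      _ = _ := by
          rw [integral_add (hI1.const_mul _) (hI2.const_mul _), integral_const_mul,
            integral_const_mul]
  linarith

lemma toReal_eLpNorm_two {E : Type*} [NormedAddCommGroup E] {μ : Measure Plane}
    {g : Plane → E} (hg : MemLp g 2 μ) :
    (eLpNorm g 2 μ).toReal = Real.sqrt (∫ x, ‖g x‖ ^ 2 ∂μ) := by
  rw [hg.eLpNorm_eq_integral_rpow_norm two_ne_zero ENNReal.ofNat_ne_top,
    ENNReal.toReal_ofReal (by positivity), Real.sqrt_eq_rpow]
  simp

lemma toReal_eLpNorm_le_add {E : Type*} [NormedAddCommGroup E] {μ : Measure Plane}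
    {g h : Plane → E} (hg : MemLp g 2 μ) (hh : MemLp h 2 μ) :
    (eLpNorm g 2 μ).toReal ≤
      (eLpNorm (fun x => g x - h x) 2 μ).toReal + (eLpNorm h 2 μ).toReal := by
  have hgh : MemLp (fun x => g x - h x) 2 μ := hg.sub hh
  rw [← ENNReal.toReal_add hgh.eLpNorm_ne_top hh.eLpNorm_ne_top]
  refine ENNReal.toReal_mono (ENNReal.add_ne_top.2 ⟨hgh.eLpNorm_ne_top, hh.eLpNorm_ne_top⟩) ?_
  have := eLpNorm_add_le hgh.aestronglyMeasurable hh.aestronglyMeasurable one_le_two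
  convert this using 2
  ext x
  simp

/-- Poincaré's inequality in `H¹₀(Ω)`. -/
lemma sqrt_integral_sq_le_gradNorm {Ω : Set Plane} (hΩ : IsOpen Ω) {D : ℝ} (hD : 0 ≤ D)
    (hΩD : Ω ⊆ Metric.closedBall 0 D) {u : Plane → ℝ} (hu : MemH10 Ω u) :
    Real.sqrt (∫ x in Ω, u x ^ 2) ≤ 2 * D * gradNorm Ω u := by
  set μ := volume.restrict Ω
  have hG2 := hu.1.memLp_weakGradient hΩ
  have hgrad : gradNorm Ω u = (eLpNorm (weakGradient Ω u) 2 μ).toReal :=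
    (toReal_eLpNorm_two hG2).symm
  have hun : Real.sqrt (∫ x in Ω, u x ^ 2) = (eLpNorm u 2 μ).toReal := by
    rw [toReal_eLpNorm_two hu.1.1]
    simp only [Real.norm_eq_abs, sq_abs]
  refine le_of_forall_pos_le_add fun δ hδ => ?_
  -- Replacing `u` by `φ` costs one `H¹` error on the left and `2D` times that error on the gradient
  -- side, hence the factor `1 + 2D`.
  obtain ⟨φ, hφ, hlt⟩ := hu.2 (δ / (1 + 2 * D)) (by positivity)
  have hφ2 : MemLp φ 2 μ := hφ.memLp.restrict Ω
  have hdφ2 : MemLp (classicalGradient φ) 2 μ := hφ.memLp_classicalGradient.restrict Ω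
  have hsub := hu.1.isWeakGradient.sub hφ.isWeakGradient
  -- The weak gradient of the difference is a separate choice, so it agrees with the difference of
  -- the gradients only almost everywhere.
  have hae : weakGradient Ω (fun x => u x - φ x) =ᵐ[μ]
      fun x => weakGradient Ω u x - classicalGradient φ x := hsub.weakGradient.ae_eq hΩ hsub
  have hd2 : MemLp (fun x => weakGradient Ω u x - classicalGradient φ x) 2 μ := hG2.sub hdφ2
  have hs2 : MemLp (fun x => u x - φ x) 2 μ := hu.1.1.sub hφ2
  have h1 : (eLpNorm (fun x => u x - φ x) 2 μ).toReal ≤ h1Norm Ω (fun x => u x - φ x) := by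
    rw [toReal_eLpNorm_two hs2]
    apply Real.sqrt_le_sqrt
    simp only [Real.norm_eq_abs, sq_abs]
    exact le_add_of_nonneg_left (integral_nonneg fun _ => by positivity)
  have h2 : (eLpNorm (fun x => weakGradient Ω u x - classicalGradient φ x) 2 μ).toReal ≤
      h1Norm Ω (fun x => u x - φ x) := by
    rw [← eLpNorm_congr_ae hae, toReal_eLpNorm_two ((memLp_congr_ae hae).2 hd2)]
    apply Real.sqrt_le_sqrt
    exact le_add_of_nonneg_right (integral_nonneg fun _ => by positivity)
  have h3 : (eLpNorm φ 2 μ).toReal ≤ 2 * D * (eLpNorm (classicalGradient φ) 2 μ).toReal := by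
    rw [toReal_eLpNorm_two hφ2, toReal_eLpNorm_two hdφ2]
    apply Real.sqrt_le_iff.2
    refine ⟨by positivity, ?_⟩
    rw [mul_pow, Real.sq_sqrt (integral_nonneg fun _ => by positivity)]
    rw [setIntegral_eq_integral_of_forall_compl_eq_zero fun x hx => by
        rw [image_eq_zero_of_notMem_tsupport fun h => hx (hφ.2.2 h)]; simp,
      setIntegral_eq_integral_of_forall_compl_eq_zero fun x hx => by
        have : classicalGradient φ x = 0 := by
          have hf : fderiv ℝ φ x = 0 :=
            image_eq_zero_of_notMem_tsupport fun h => hx (hφ.2.2 (tsupport_fderiv_subset ℝ h))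
          ext i
          simp [classicalGradient, hf]
        rw [this]; simp]
    exact hφ.integral_sq_le hD hΩD
  have h4 := toReal_eLpNorm_le_add hu.1.1 hφ2
  have h5 : (eLpNorm (classicalGradient φ) 2 μ).toReal ≤
      (eLpNorm (fun x => weakGradient Ω u x - classicalGradient φ x) 2 μ).toReal +
        (eLpNorm (weakGradient Ω u) 2 μ).toReal := by
    have := toReal_eLpNorm_le_add hdφ2 hG2
    rwa [show (fun x => classicalGradient φ x - weakGradient Ω u x) =
      -(fun x => weakGradient Ω u x - classicalGradient φ x) by ext x; simp, eLpNorm_neg] at this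
  rw [hun, hgrad]
  rw [lt_div_iff₀ (by positivity)] at hlt
  have h6 : 2 * D * (eLpNorm (classicalGradient φ) 2 μ).toReal ≤
      2 * D * (h1Norm Ω (fun x => u x - φ x) + (eLpNorm (weakGradient Ω u) 2 μ).toReal) := by
    gcongr
    linarith
  linarith

lemma exists_h1Norm_le_gradNorm {Ω : Set Plane} (hΩ : IsOpen Ω) (hb : Bornology.IsBounded Ω) :
    ∃ C : ℝ, 0 < C ∧ ∀ u : Plane → ℝ, MemH10 Ω u → h1Norm Ω u ≤ C * gradNorm Ω u := by
  obtain ⟨D, hD, hΩD⟩ := hb.subset_closedBall_lt 0 0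
  refine ⟨1 + 2 * D, by positivity, fun u hu => ?_⟩
  have h1 := sqrt_integral_sq_le_gradNorm hΩ hD.le hΩD hu
  have hA : 0 ≤ ∫ x in Ω, ‖weakGradient Ω u x‖ ^ 2 := integral_nonneg fun _ => by positivity
  have hB : 0 ≤ ∫ x in Ω, u x ^ 2 := integral_nonneg fun _ => by positivity
  have h2 : h1Norm Ω u ≤ gradNorm Ω u + Real.sqrt (∫ x in Ω, u x ^ 2) := by
    refine Real.sqrt_le_iff.2 ⟨add_nonneg (Real.sqrt_nonneg _) (Real.sqrt_nonneg _), ?_⟩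
    unfold gradNorm
    rw [add_sq, Real.sq_sqrt hA, Real.sq_sqrt hB]
    have := mul_nonneg (Real.sqrt_nonneg (∫ x in Ω, ‖weakGradient Ω u x‖ ^ 2))
      (Real.sqrt_nonneg (∫ x in Ω, u x ^ 2))
    linarith
  linarith

end OrliczPlane

theorem lemma3p2 (Ω : Set OrliczPlane.Plane)
    (hΩ : OrliczPlane.IsSmoothBoundedDomain Ω ∨ Ω = Set.univ) :
    (∃ C : ℝ, 0 < C ∧ ∀ u : OrliczPlane.Plane → ℝ, OrliczPlane.MemH1 Ω u →
      OrliczPlane.MemE OrliczPlane.Phi Ω u ∧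
        OrliczPlane.luxemburgNorm OrliczPlane.Phi Ω u ≤ C * OrliczPlane.h1Norm Ω u) ∧
    (∃ C : ℝ, 0 < C ∧ ∀ u : OrliczPlane.Plane → ℝ, OrliczPlane.MemH10 Ω u →
      OrliczPlane.MemE OrliczPlane.Phi Ω u ∧
        OrliczPlane.luxemburgNorm OrliczPlane.Phi Ω u ≤ C * OrliczPlane.h1Norm Ω u) ∧
    (Bornology.IsBounded Ω →
      ∃ C : ℝ, 0 < C ∧ ∀ u : OrliczPlane.Plane → ℝ, OrliczPlane.MemH10 Ω u →
        OrliczPlane.MemE OrliczPlane.Phi Ω u ∧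
          OrliczPlane.luxemburgNorm OrliczPlane.Phi Ω u ≤ C * OrliczPlane.gradNorm Ω u) := by
  obtain ⟨C, hC, h⟩ := OrliczPlane.exists_luxemburgNorm_le_h1Norm hΩ
  refine ⟨⟨C, hC, h⟩, ⟨C, hC, fun u hu => h u hu.1⟩, fun hb => ?_⟩
  obtain ⟨K, hK, hP⟩ := OrliczPlane.exists_h1Norm_le_gradNorm
    (OrliczPlane.isOpen_of_isSmoothBoundedDomain_or_univ hΩ) hb
  refine ⟨C * K, by positivity, fun u hu => ⟨(h u hu.1).1, (h u hu.1).2.trans ?_⟩⟩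
  rw [mul_assoc]
  exact mul_le_mul_of_nonneg_left (hP u hu) hC.le
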